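/- Let $D$ be an integral domain with quotient field $K$, let $F(D)$ be the set of nonzero fractional ideals of $D$, and let $\ast : F(D)\to F(D)$, $A\mapsto A_\ast$, be a star-operation on $D$ (that is, for $A,B\in F(D)$ and $0\neq x\in K$: $(x)_\ast=(x)$, $(xA)_\ast=xA_\ast$; $A\subseteq A_\ast$; $A\subseteq B$ implies $A_\ast\subseteq B_\ast$; $(A_\ast)_\ast=A_\ast$). Put $A_{\ast_s}=\bigcup\{B_\ast\mid 0\ne B\subseteq A,\ B \text{ a finitely generated fractional ideal}\}$, and assume that $\ast$ has finite character, i.e. $A_\ast=A_{\ast_s}$ for all $A\in F(D)$. **Terminology.** - $A\in F(D)$ is $\ast$-invertible if $(AA^{-1})_\ast=D$ (similarly $\ast_s$-invertible), where $A^{-1}=\{x\in K\mid xA\subseteq D\}$. A $\ast$-product of ideals $A_1,\dots,A_k$ ($1\le k<\infty$) is $(A_1\cdots A_k)_\ast$. - $\ast\text{-}\mathrm{Max}(D)$ is the set of maximal $\ast$-ideals, i.e. of the ideals maximal among the nonzero proper ideals $I$ of $D$ with $I_\ast=I$ (they are prime); $X^{(1)}(D)$ is the set of height-one primes of $D$.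 - A set $\mathscr F$ of primes is a defining family if $D=\bigcap_{P\in\mathscr F}D_P$ (inside $K$); it is locally finite if every nonzero nonunit of $D$ lies in only finitely many members of $\mathscr F$; it is independent if no two distinct members contain a common nonzero prime ideal. $D$ is $\ast$-h-local if $\ast\text{-}\mathrm{Max}(D)$ is an independent, locally finite defining family; $D$ is a $\ast$-WKD if it is $\ast$-h-local and $\ast\text{-}\mathrm{Max}(D)=X^{(1)}(D)$. - A domain $R$ is an AV-domain if for all nonzero $a,b\in R$ there is $n\ge1$ with $a^n\mid b^n$ or $b^n\mid a^n$. $D$ is a $\ast$-almost IRKT if it is $\ast$-h-local and $D_P$ is an AV-domain for every $P\in\ast\text{-}\mathrm{Max}(D)$. $D$ is a $\ast$-AGKD if $X^{(1)}(D)$ is a locally finite defining family, $\ast\text{-}\mathrm{Max}(D)=X^{(1)}(D)$, and $D_P$ is an AV-domain for every $P\in\ast\text{-}\mathrm{Max}(D)$. - $D$ is an AP$\ast$MD if for all nonzero $a,b\in D$ there is $n\ge1$ such that $(a^n,b^n)$ is $\ast_s$-invertible. - A nonzero finitely generated ideal $A$ of $D$ is $\ast$-homogeneous if it is contained in a unique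 maximal $\ast$-ideal, denoted $M(A)$; it has type 1 if moreover $M(A)=\sqrt{A_\ast}$. $D$ is $\ast$-potent if every maximal $\ast$-ideal contains a $\ast$-homogeneous ideal. - An ideal $A$ is $\ast$-almost super-homogeneous if it is $\ast$-invertible and $\ast$-homogeneous and, whenever $b_1,\dots,b_s\in M(A)$ satisfy $A^r\subseteq(b_1,\dots,b_s)_\ast$ for some $r\ge1$, there is $n\ge1$ such that $(b_1^n,\dots,b_s^n)$ is $\ast$-invertible. $D$ is a type 1 $\ast$-almost super-SH domain if every nonzero proper principal ideal of $D$ is a $\ast$-product of type 1 $\ast$-almost super-homogeneous ideals. **Theorem.** The following statements are equivalent. 1. $D$ is a $\ast$-AGKD. 2. $D$ is an AP$\ast$MD and a $\ast$-WKD. 3. $D$ is a $\ast$-potent AP$\ast$MD with $X^{(1)}(D)=\ast\text{-}\mathrm{Max}(D)$. 4. $D$ is a $\ast$-almost IRKT and a $\ast$-WKD. 5. $D$ is a $\ast$-almost IRKT and every $\ast$-invertible $\ast$-homogeneous ideal of $D$ has type 1. 6. $D$ is $\ast$-h-local and every $\ast$-invertible $\ast$-homogeneous ideal of $D$ is $\ast$-almost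 super-homogeneous and has type 1. 7. $D$ is a type 1 $\ast$-almost super-SH domain. 8. For every finitely generated $\ast$-invertible ideal $A$ of $D$ with $A_\ast\neq D$, the ideal $A_\ast$ is a $\ast$-product of type 1 $\ast$-almost super-homogeneous ideals. -/

import Mathlib

open scoped nonZeroDivisors

noncomputable section

section

variable (D : Type*) [CommRing D] [IsDomain D]
  (K : Type*) [Field K] [Algebra D K] [IsFractionRing D K]

/-- A star-operation on the domain `D` with quotient field `K`.  Mathlib's type of fractional ideals
contains the zero ideal; a star-operation is a map on the nonzero ones, and it is extended here by the
convention `0 ↦ 0`, which makes all the laws below hold trivially at `0`. -/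
structure StarOperation where
  toFun : FractionalIdeal D⁰ K → FractionalIdeal D⁰ K
  map_zero : toFun 0 = 0
  map_spanSingleton : ∀ x : K, x ≠ 0 →
    toFun (FractionalIdeal.spanSingleton D⁰ x) = FractionalIdeal.spanSingleton D⁰ x
  map_spanSingleton_mul : ∀ (x : K) (A : FractionalIdeal D⁰ K), x ≠ 0 →
    toFun (FractionalIdeal.spanSingleton D⁰ x * A) = FractionalIdeal.spanSingleton D⁰ x * toFun A
  le_toFun : ∀ A : FractionalIdeal D⁰ K, A ≤ toFun A
  mono : ∀ A B : FractionalIdeal D⁰ K, A ≤ B → toFun A ≤ toFun B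
  idem : ∀ A : FractionalIdeal D⁰ K, toFun (toFun A) = toFun A

end

section

variable {D : Type*} [CommRing D] [IsDomain D]
  {K : Type*} [Field K] [Algebra D K] [IsFractionRing D K]

namespace StarOperation

/-- The set `A_{∗ₛ} = ⋃ {B_∗ ∣ 0 ≠ B ⊆ A, B a finitely generated fractional ideal}`. -/
def finiteClosure (star : StarOperation D K) (A : FractionalIdeal D⁰ K) : Set K :=
  {x | ∃ B : FractionalIdeal D⁰ K, B ≠ 0 ∧ (B : Submodule D K).FG ∧ B ≤ A ∧ x ∈ star.toFun B}

/-- `∗` is of finite character: `A_∗ = A_{∗ₛ}` for every nonzero fractional ideal `A`. -/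
def IsFiniteCharacter (star : StarOperation D K) : Prop :=
  ∀ A : FractionalIdeal D⁰ K, A ≠ 0 → {x : K | x ∈ star.toFun A} = star.finiteClosure A

/-- `A` is `∗`-invertible: `(A A⁻¹)_∗ = D`. -/
def IsInvertible (star : StarOperation D K) (A : FractionalIdeal D⁰ K) : Prop :=
  star.toFun (A * A⁻¹) = 1

/-- `A` is `∗ₛ`-invertible: `(A A⁻¹)_{∗ₛ} = D`. -/
def IsFinitelyInvertible (star : StarOperation D K) (A : FractionalIdeal D⁰ K) : Prop :=
  star.finiteClosure (A * A⁻¹) = {x : K | x ∈ (1 : FractionalIdeal D⁰ K)}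

/-- For an (integral) ideal `A` of `D`, the ideal `A_∗` of `D`. -/
def closure (star : StarOperation D K) (A : Ideal D) : Ideal D :=
  (star.toFun (A : FractionalIdeal D⁰ K) : Submodule D K).comap (Algebra.linearMap D K)

theorem mem_closure (star : StarOperation D K) (A : Ideal D) (x : D) :
    x ∈ star.closure A ↔ algebraMap D K x ∈ star.toFun (A : FractionalIdeal D⁰ K) :=
  Iff.rfl

/-- Viewed in `K`, `star.closure A` is the value of `∗` at `A`. -/
theorem coe_closure (star : StarOperation D K) (A : Ideal D) :
    (star.closure A : FractionalIdeal D⁰ K) = star.toFun (A : FractionalIdeal D⁰ K) := by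
  have h1 : star.toFun (A : FractionalIdeal D⁰ K) ≤ 1 := by
    have h := star.mono _ _ (FractionalIdeal.coeIdeal_le_one (S := D⁰) (P := K) (I := A))
    have h' := star.map_spanSingleton 1 one_ne_zero
    rw [FractionalIdeal.spanSingleton_one] at h'
    rwa [h'] at h
  ext y
  rw [FractionalIdeal.mem_coeIdeal]
  constructor
  · rintro ⟨x, hx, rfl⟩
    exact hx
  · intro hy
    obtain ⟨x, rfl⟩ := (FractionalIdeal.mem_one_iff D⁰).1 (h1 hy)
    exact ⟨x, hy, rfl⟩

/-- `P` is a maximal `∗`-ideal: maximal among the proper nonzero ideals `I` with `I_∗ = I`. -/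
def IsMaximalStarIdeal (star : StarOperation D K) (P : Ideal D) : Prop :=
  Maximal (fun I : Ideal D => I ≠ ⊥ ∧ I ≠ ⊤ ∧ star.closure I = I) P

/-- Every maximal `∗`-ideal is prime, so that `∗-Max(D)` may be taken as a subset of `Spec(D)`. -/
theorem IsMaximalStarIdeal.isPrime {star : StarOperation D K} {P : Ideal D}
    (hP : star.IsMaximalStarIdeal P) : P.IsPrime := by
  obtain ⟨⟨hP0, hP1, hPs⟩, hmax⟩ := hP
  refine ⟨hP1, fun {a b} hab => ?_⟩
  by_contra! hcon
  obtain ⟨ha, hb⟩ := hcon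
  have hb0 : algebraMap D K b ≠ 0 := by
    intro h
    exact hb ((IsFractionRing.injective D K (by simpa using h) : b = 0) ▸ P.zero_mem)
  have hle : ∀ I : Ideal D, I ≤ star.closure I := fun I x hx =>
    star.le_toFun _ ((FractionalIdeal.mem_coeIdeal D⁰).2 ⟨x, hx, rfl⟩)
  have hidem : ∀ I : Ideal D, star.closure (star.closure I) = star.closure I := by
    intro I
    ext x
    rw [mem_closure, coe_closure, star.idem, mem_closure]
  set J : Ideal D := P ⊔ Ideal.span {a} with hJ
  have hPJ : P ≤ star.closure J := le_sup_left.trans (hle J)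
  have haJ : a ∈ star.closure J :=
    hle J (Ideal.mem_sup_right (Ideal.mem_span_singleton_self a))
  have htop : star.closure J = ⊤ := by
    by_contra hne
    refine ha (hmax ⟨fun h => hP0 (le_bot_iff.1 (h ▸ hPJ)), hne, hidem J⟩ hPJ haJ)
  have h1 : (1 : K) ∈ star.toFun (J : FractionalIdeal D⁰ K) := by
    have : (1 : D) ∈ star.closure J := htop ▸ Submodule.mem_top
    simpa [mem_closure] using this
  have h2 : algebraMap D K b ∈
      star.toFun (FractionalIdeal.spanSingleton D⁰ (algebraMap D K b) * J) := by
    rw [star.map_spanSingleton_mul _ _ hb0]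
    exact FractionalIdeal.mem_singleton_mul.2 ⟨1, h1, by simp⟩
  have h3 : FractionalIdeal.spanSingleton D⁰ (algebraMap D K b) * (J : FractionalIdeal D⁰ K) ≤
      (P : FractionalIdeal D⁰ K) := by
    rw [← FractionalIdeal.coeIdeal_span_singleton, ← FractionalIdeal.coeIdeal_mul,
      FractionalIdeal.coeIdeal_le_coeIdeal, hJ, Ideal.mul_sup, sup_le_iff]
    refine ⟨Ideal.mul_le_right, ?_⟩
    rw [Ideal.span_singleton_mul_span_singleton, Ideal.span_singleton_le_iff_mem, mul_comm]
    exact hab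
  have h4 : b ∈ star.closure P := star.mono _ _ h3 h2
  exact hb (hPs ▸ h4)

/-- `∗-Max(D)`, the set of maximal `∗`-ideals of `D`. -/
def maxSpec (star : StarOperation D K) : Set (PrimeSpectrum D) :=
  {P | star.IsMaximalStarIdeal P.asIdeal}

end StarOperation

/-- `X⁽¹⁾(D)`, the set of height-one prime ideals of `D`. -/
def heightOnePrimes (D : Type*) [CommRing D] : Set (PrimeSpectrum D) :=
  {P | P.asIdeal.height = 1}

/-- `R` is an almost valuation domain. -/
def IsAVDomain (R : Type*) [CommRing R] : Prop :=
  IsDomain R ∧ ∀ a b : R, a ≠ 0 → b ≠ 0 → ∃ n : ℕ, 1 ≤ n ∧ (a ^ n ∣ b ^ n ∨ b ^ n ∣ a ^ n)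

/-- The localization `D_P` as a subset of `K`: all fractions `a / s` with `a ∈ D`, `s ∈ D ∖ P`. -/
def localizationIn (K : Type*) [Field K] [Algebra D K] (P : PrimeSpectrum D) : Set K :=
  {x | ∃ a s : D, s ∉ P.asIdeal ∧ x = algebraMap D K a / algebraMap D K s}

/-- `F` is a defining family of `D`: `D = ⋂_{P ∈ F} D_P` inside `K`. -/
def IsDefiningFamily (K : Type*) [Field K] [Algebra D K] (F : Set (PrimeSpectrum D)) : Prop :=
  Set.range (algebraMap D K) = ⋂ P ∈ F, localizationIn K P

/-- `F` is of finite character (locally finite): every nonzero nonunit of `D` lies in only finitely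
many members of `F`. -/
def IsLocallyFiniteFamily (F : Set (PrimeSpectrum D)) : Prop :=
  ∀ x : D, x ≠ 0 → ¬ IsUnit x → {P ∈ F | x ∈ P.asIdeal}.Finite

/-- `F` is independent: no two distinct members of `F` contain a common nonzero prime ideal. -/
def IsIndependentFamily (F : Set (PrimeSpectrum D)) : Prop :=
  ∀ P ∈ F, ∀ Q ∈ F, P ≠ Q →
    ¬ ∃ N : Ideal D, N.IsPrime ∧ N ≠ ⊥ ∧ N ≤ P.asIdeal ∧ N ≤ Q.asIdeal

namespace StarOperation

/-- `D` is `∗`-h-local: `∗-Max(D)` is an independent defining family of finite character. -/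
def IsHLocal (star : StarOperation D K) : Prop :=
  IsDefiningFamily K star.maxSpec ∧ IsIndependentFamily star.maxSpec ∧
    IsLocallyFiniteFamily star.maxSpec

/-- `D` is a `∗`-weakly Krull domain (`∗`-WKD). -/
def IsWKD (star : StarOperation D K) : Prop :=
  star.IsHLocal ∧ star.maxSpec = heightOnePrimes D

/-- `D_P` is an almost valuation domain for each `P ∈ ∗-Max(D)`. -/
def IsLocallyAV (star : StarOperation D K) : Prop :=
  ∀ P ∈ star.maxSpec, IsAVDomain (Localization.AtPrime P.asIdeal)

/-- `D` is a `∗`-almost independent ring of Krull type (`∗`-almost IRKT). -/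
def IsAlmostIRKT (star : StarOperation D K) : Prop :=
  star.IsHLocal ∧ star.IsLocallyAV

/-- `D` is a `∗`-almost generalized Krull domain (`∗`-AGKD). -/
def IsAGKD (star : StarOperation D K) : Prop :=
  (IsDefiningFamily K (heightOnePrimes D) ∧ IsLocallyFiniteFamily (heightOnePrimes D)) ∧
    star.maxSpec = heightOnePrimes D ∧ star.IsLocallyAV

/-- `D` is an almost Prüfer `∗`-multiplication domain (AP∗MD): for all nonzero `a`, `b` some
`(aⁿ, bⁿ)`, `n ≥ 1`, is `∗ₛ`-invertible. -/
def IsAPMD (star : StarOperation D K) : Prop :=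
  ∀ a b : D, a ≠ 0 → b ≠ 0 → ∃ n : ℕ, 1 ≤ n ∧
    star.IsFinitelyInvertible ((Ideal.span {a ^ n, b ^ n} : Ideal D) : FractionalIdeal D⁰ K)

/-- `A` is `P`-`∗`-homogeneous: nonzero, finitely generated, and `P` is the unique maximal `∗`-ideal
containing `A`. -/
def IsHomogeneousAt (star : StarOperation D K) (P : PrimeSpectrum D) (A : Ideal D) : Prop :=
  A ≠ ⊥ ∧ A.FG ∧ P ∈ star.maxSpec ∧ A ≤ P.asIdeal ∧
    ∀ Q ∈ star.maxSpec, A ≤ Q.asIdeal → Q = P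

/-- `A` is `∗`-homogeneous. -/
def IsHomogeneous (star : StarOperation D K) (A : Ideal D) : Prop :=
  ∃ P : PrimeSpectrum D, star.IsHomogeneousAt P A

/-- `A` is a type 1 `∗`-homogeneous ideal: `∗`-homogeneous with `M(A) = √(A_∗)`. -/
def IsTypeOne (star : StarOperation D K) (A : Ideal D) : Prop :=
  ∃ P : PrimeSpectrum D, star.IsHomogeneousAt P A ∧ P.asIdeal = (star.closure A).radical

/-- `A` is a `∗`-almost super-homogeneous ideal. -/
def IsAlmostSuperHomogeneous (star : StarOperation D K) (A : Ideal D) : Prop :=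
  star.IsInvertible (A : FractionalIdeal D⁰ K) ∧
  ∃ P : PrimeSpectrum D, star.IsHomogeneousAt P A ∧
    ∀ (s : ℕ) (b : Fin s → D), (∀ i, b i ∈ P.asIdeal) →
      (∃ r : ℕ, 1 ≤ r ∧ A ^ r ≤ star.closure (Ideal.span (Set.range b))) →
      ∃ n : ℕ, 1 ≤ n ∧ star.IsInvertible
        ((Ideal.span (Set.range fun i => b i ^ n) : Ideal D) : FractionalIdeal D⁰ K)

/-- The ideal `I` is a (finite) `∗`-product `(A₁ ⋯ A_k)_∗`, `k ≥ 1`, of ideals with property `p`. -/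
def IsStarProductOf (star : StarOperation D K) (p : Ideal D → Prop) (I : Ideal D) : Prop :=
  ∃ l : List (Ideal D), l ≠ [] ∧ (∀ A ∈ l, p A) ∧ I = star.closure l.prod

/-- A type 1 `∗`-almost super-homogeneous ideal. -/
def IsTypeOneAlmostSuperHomogeneous (star : StarOperation D K) (A : Ideal D) : Prop :=
  star.IsAlmostSuperHomogeneous A ∧ star.IsTypeOne A

/-- `D` is a type 1 `∗`-almost super-SH domain: every nonzero proper principal ideal is a `∗`-product
of type 1 `∗`-almost super-homogeneous ideals. -/
def IsTypeOneAlmostSuperSHDomain (star : StarOperation D K) : Prop :=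
  ∀ x : D, x ≠ 0 → ¬ IsUnit x →
    star.IsStarProductOf star.IsTypeOneAlmostSuperHomogeneous (Ideal.span {x})

/-- `D` is `∗`-potent: every maximal `∗`-ideal contains a `∗`-homogeneous ideal. -/
def IsPotent (star : StarOperation D K) : Prop :=
  ∀ P ∈ star.maxSpec, ∃ A : Ideal D, star.IsHomogeneous A ∧ A ≤ P.asIdeal

end StarOperation

end

end

/-!
For a star-operation `∗` of finite character, Zorn's lemma provides maximal `∗`-ideals, and
membership in a `∗`-ideal can be tested locally at them (`mem_closure_of_forall_maxSpec`).  This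
translates all the conditions into divisibility in the rings `D_P`, `P ∈ ∗-Max(D)`, which is
written inside `D` as `LocallyDvd P a b`, that is `a ∣ s * b` for some `s ∉ P`.  In particular a
finitely generated nonzero ideal is `∗`-invertible if and only if it is principal in every `D_P`
(`isInvertible_iff`), so that AP∗MD implies that the `D_P` are almost valuation domains, the converse
being true under local finiteness.  All the conditions turn out to be equivalent to being a
`∗`-AGKD, and three further ideas carry the proof.

* If `P` has height one and `0 ≠ x ∈ P`, then `P D_P` is the radical of `x D_P`.  Hence height-one
  primes are `∗`-ideals, homogeneous ideals at `P` have type 1, and potency implies local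
  finiteness (`isLocallyFiniteFamily_of_isPotent`).
* If `∗-Max(D)` is independent and locally finite, then for `0 ≠ x ∈ P` there is a `∗`-invertible
  homogeneous ideal `B` with `x ∈ B ⊆ x D_P ∩ D` (`exists_isHomogeneousAt`).  Such ideals are the
  factors of `∗`-invertible ideals (`IsHLocal.isStarProductOf`), and if they all have type 1,
  there is no nonzero prime strictly inside `P`.
* In an almost valuation domain finitely many elements have powers, with a common exponent, that
  are linearly ordered by divisibility, which makes invertible homogeneous ideals almost
  super-homogeneous.  Conversely, if `P` contains an almost super-homogeneous ideal of type 1,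
  then for `a, b ∈ P` the homogeneous ideals attached to `a` and `b` generate an ideal whose
  generators have powers that generate an invertible ideal; in the local ring `D_P` one of them
  generates it, and this compares powers of `a` and `b`
  (`IsTypeOneAlmostSuperSHDomain.isLocallyAV`).
-/

set_option linter.unusedSectionVars false

/-! ### The closure operator on integral ideals -/

section

variable {D : Type*} [CommRing D] [IsDomain D]
  {K : Type*} [Field K] [Algebra D K] [IsFractionRing D K]

namespace StarOperation

variable (star : StarOperation D K)

theorem closure_mono {I J : Ideal D} (h : I ≤ J) : star.closure I ≤ star.closure J :=
  fun _ hx => star.mono _ _ ((FractionalIdeal.coeIdeal_le_coeIdeal K).2 h) hx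

theorem le_closure (I : Ideal D) : I ≤ star.closure I := fun x hx =>
  star.le_toFun _ ((FractionalIdeal.mem_coeIdeal D⁰).2 ⟨x, hx, rfl⟩)

theorem closure_closure (I : Ideal D) : star.closure (star.closure I) = star.closure I := by
  ext x
  rw [mem_closure, coe_closure, star.idem, mem_closure]

theorem closure_bot : star.closure (⊥ : Ideal D) = ⊥ := by
  ext x
  rw [mem_closure, FractionalIdeal.coeIdeal_bot, star.map_zero, FractionalIdeal.mem_zero_iff,
    Ideal.mem_bot, FaithfulSMul.algebraMap_eq_zero_iff]

theorem closure_span_singleton (a : D) :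
    star.closure (Ideal.span {a}) = Ideal.span {a} := by
  rcases eq_or_ne a 0 with rfl | ha
  · rw [Ideal.span_singleton_eq_bot.2 rfl, closure_bot]
  · have ha' : algebraMap D K a ≠ 0 := by simpa using ha
    rw [← FractionalIdeal.coeIdeal_inj (K := K), coe_closure,
      FractionalIdeal.coeIdeal_span_singleton, star.map_spanSingleton _ ha']

variable {star}

/-- If `a * I ⊆ J` then `a * I_∗ ⊆ J_∗`. -/
theorem mul_mem_closure {a x : D} {I J : Ideal D} (h : ∀ y ∈ I, a * y ∈ J)
    (hx : x ∈ star.closure I) : a * x ∈ star.closure J := by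
  rcases eq_or_ne a 0 with rfl | ha
  · simp
  · have ha' : algebraMap D K a ≠ 0 := by simpa using ha
    have hle : Ideal.span {a} * I ≤ J := by
      rw [Ideal.span_singleton_mul_le_iff]
      exact h
    refine star.closure_mono hle ?_
    rw [mem_closure, FractionalIdeal.coeIdeal_mul, FractionalIdeal.coeIdeal_span_singleton,
      star.map_spanSingleton_mul _ _ ha']
    exact FractionalIdeal.mem_singleton_mul.2 ⟨_, hx, map_mul _ _ _⟩

/-- If `a * I` lies in a `∗`-ideal `J`, then so does `a * I_∗`. -/
theorem mul_mem_of_mem_closure {a x : D} {I J : Ideal D} (hJ : star.closure J = J)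
    (h : ∀ y ∈ I, a * y ∈ J) (hx : x ∈ star.closure I) : a * x ∈ J :=
  hJ ▸ mul_mem_closure h hx

theorem closure_mul_closure_le (I J : Ideal D) :
    star.closure I * star.closure J ≤ star.closure (I * J) := by
  rw [Ideal.mul_le]
  intro x hx y hy
  refine mul_mem_of_mem_closure (star.closure_closure _) (fun b hb => ?_) hy
  rw [mul_comm x b]
  exact mul_mem_closure (fun z hz => mul_comm b z ▸ Ideal.mul_mem_mul hz hb) hx

theorem closure_pow_le (I : Ideal D) (n : ℕ) : star.closure I ^ n ≤ star.closure (I ^ n) := by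
  induction n with
  | zero => simpa using star.le_closure ⊤
  | succ n ih =>
    rw [pow_succ, pow_succ]
    exact (Ideal.mul_mono_left ih).trans (closure_mul_closure_le _ _)

theorem exists_fg_of_mem_closure (hstar : star.IsFiniteCharacter) {I : Ideal D} {x : D}
    (hx : x ∈ star.closure I) : ∃ B : Ideal D, B.FG ∧ B ≤ I ∧ x ∈ star.closure B := by
  rcases eq_or_ne I ⊥ with rfl | hI
  · exact ⟨⊥, Submodule.fg_bot, le_rfl, hx⟩
  · have h : algebraMap D K x ∈ star.finiteClosure (I : FractionalIdeal D⁰ K) := by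
      rw [← hstar _ (FractionalIdeal.coeIdeal_ne_zero.2 hI)]
      exact hx
    obtain ⟨B, -, hfg, hle, hxB⟩ := h
    obtain ⟨B', rfl⟩ :=
      FractionalIdeal.le_one_iff_exists_coeIdeal.1 (hle.trans FractionalIdeal.coeIdeal_le_one)
    exact ⟨B', (FractionalIdeal.coeIdeal_fg D⁰ (IsFractionRing.injective D K) B').1 hfg,
      (FractionalIdeal.coeIdeal_le_coeIdeal K).1 hle, hxB⟩

/-! ### Maximal star-ideals -/

/-- Under finite character the union of a chain of `∗`-ideals is a `∗`-ideal, so Zorn's lemma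
provides maximal `∗`-ideals. -/
theorem exists_le_maxSpec (hstar : star.IsFiniteCharacter) {I : Ideal D} (hI : I ≠ ⊥)
    (hI' : star.closure I ≠ ⊤) : ∃ P ∈ star.maxSpec, I ≤ P.asIdeal := by
  have hz := zorn_le_nonempty₀ {J : Ideal D | J ≠ ⊥ ∧ J ≠ ⊤ ∧ star.closure J = J} ?_
    (star.closure I) ⟨fun h => hI (le_bot_iff.1 (h ▸ star.le_closure I)), hI',
      star.closure_closure I⟩
  · obtain ⟨P, hIP, hP⟩ := hz
    have hP' : star.IsMaximalStarIdeal P := hP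
    exact ⟨⟨P, hP'.isPrime⟩, hP', (star.le_closure I).trans hIP⟩
  · intro c hc hchain J₀ hJ₀
    have hne : c.Nonempty := ⟨J₀, hJ₀⟩
    have hdir : DirectedOn (· ≤ ·) c := hchain.directedOn
    refine ⟨sSup c, ⟨?_, ?_, ?_⟩, fun J hJ => le_sSup hJ⟩
    · exact fun h => (hc hJ₀).1 (le_bot_iff.1 (h ▸ le_sSup hJ₀))
    · rw [Ideal.ne_top_iff_one, Submodule.mem_sSup_of_directed hne hdir]
      rintro ⟨J, hJ, h1⟩
      exact (hc hJ).2.1 ((Ideal.eq_top_iff_one _).2 h1)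
    · refine le_antisymm (fun x hx => ?_) (star.le_closure _)
      obtain ⟨B, hfg, hB, hxB⟩ := exists_fg_of_mem_closure hstar hx
      obtain ⟨J, hJ, hBJ⟩ := (CompleteLattice.isCompactElement_iff_le_of_directed_sSup_le _ _).1
        ((Submodule.fg_iff_compact B).1 hfg) c hne hdir hB
      exact le_sSup hJ ((hc hJ).2.2 ▸ star.closure_mono hBJ hxB)

variable {P Q : PrimeSpectrum D}

theorem ne_bot_of_mem_maxSpec (hP : P ∈ star.maxSpec) : P.asIdeal ≠ ⊥ :=
  (Set.mem_ofPred.1 hP).prop.1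

theorem closure_eq_of_mem_maxSpec (hP : P ∈ star.maxSpec) :
    star.closure P.asIdeal = P.asIdeal :=
  (Set.mem_ofPred.1 hP).prop.2.2

theorem eq_of_le_of_mem_maxSpec (hP : P ∈ star.maxSpec) (hQ : Q ∈ star.maxSpec)
    (h : P.asIdeal ≤ Q.asIdeal) : P = Q :=
  PrimeSpectrum.ext (le_antisymm h ((Set.mem_ofPred.1 hP).le_of_ge (Set.mem_ofPred.1 hQ).prop h))

theorem closure_le_of_mem_maxSpec (hP : P ∈ star.maxSpec) {I : Ideal D} (h : I ≤ P.asIdeal) :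
    star.closure I ≤ P.asIdeal :=
  (star.closure_mono h).trans (closure_eq_of_mem_maxSpec hP).le

/-- Membership in a `∗`-ideal `I_∗` can be tested locally at the maximal `∗`-ideals: the ideal
`(I_∗ : x)` is again a `∗`-ideal. -/
theorem mem_closure_of_forall_maxSpec (hstar : star.IsFiniteCharacter) {I : Ideal D} (hI : I ≠ ⊥)
    {x : D} (h : ∀ P ∈ star.maxSpec, ∃ s ∉ P.asIdeal, s * x ∈ star.closure I) :
    x ∈ star.closure I := by
  set J : Ideal D := Submodule.comap (LinearMap.mulRight D x) (star.closure I) with hJ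
  have hmem (d : D) : d ∈ J ↔ d * x ∈ star.closure I := Iff.rfl
  have hIJ : I ≤ J := fun d hd => Ideal.mul_mem_right x _ (star.le_closure I hd)
  have hcl : star.closure J ≤ J := fun d hd => by
    rw [hmem, mul_comm]
    exact mul_mem_of_mem_closure (star.closure_closure I) (fun y hy => mul_comm y x ▸ hy) hd
  have htop : star.closure J = ⊤ := by
    by_contra hne
    obtain ⟨P, hP, hJP⟩ := exists_le_maxSpec hstar (fun h0 => hI (le_bot_iff.1 (h0 ▸ hIJ))) hne
    obtain ⟨s, hs, hsx⟩ := h P hP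
    exact hs (hJP hsx)
  have h1 : (1 : D) ∈ J := hcl (htop ▸ Submodule.mem_top)
  simpa [hmem] using h1

theorem closure_eq_top_of_forall_maxSpec (hstar : star.IsFiniteCharacter) {I : Ideal D}
    (hI : I ≠ ⊥) (h : ∀ P ∈ star.maxSpec, ¬ I ≤ P.asIdeal) : star.closure I = ⊤ := by
  by_contra hne
  obtain ⟨P, hP, hIP⟩ := exists_le_maxSpec hstar hI hne
  exact h P hP hIP

/-- `∗-Max(D)` is always a defining family: for `x = a / b` the ideal `{d ∣ d x ∈ D}` is a
`∗`-ideal, as `d x ∈ D` means that `d a` lies in the `∗`-ideal `(b)`. -/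
theorem isDefiningFamily_maxSpec (hstar : star.IsFiniteCharacter) :
    IsDefiningFamily K star.maxSpec := by
  apply Set.Subset.antisymm
  · rintro _ ⟨a, rfl⟩
    refine Set.mem_iInter₂.2 fun P _ => ⟨a, 1, P.2.one_notMem, ?_⟩
    simp
  · intro x hx
    obtain ⟨a, b, hb, rfl⟩ := IsFractionRing.div_surjective (A := D) x
    have hb0 : b ≠ 0 := nonZeroDivisors.ne_zero hb
    have hb' : algebraMap D K b ≠ 0 := by simpa using hb0
    have hmem : a ∈ star.closure (Ideal.span {b}) := by
      refine mem_closure_of_forall_maxSpec hstar (by simpa using hb0) fun P hP => ?_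
      obtain ⟨c, s, hs, hcs⟩ := Set.mem_iInter₂.1 hx P hP
      refine ⟨s, hs, star.le_closure _ (Ideal.mem_span_singleton'.2 ⟨c, ?_⟩)⟩
      have hs' : algebraMap D K s ≠ 0 := by
        intro h
        exact hs ((by simpa using h : s = 0) ▸ P.asIdeal.zero_mem)
      rw [div_eq_div_iff hb' hs', ← map_mul, ← map_mul] at hcs
      rw [← IsFractionRing.injective D K hcs, mul_comm]
    rw [closure_span_singleton, Ideal.mem_span_singleton'] at hmem
    obtain ⟨c, rfl⟩ := hmem
    exact ⟨c, by rw [map_mul, mul_div_cancel_right₀ _ hb']⟩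

end StarOperation

end

/-! ### Divisibility in the localizations -/

section

variable {D : Type*} [CommRing D]

/-- `a` divides `b` in the localization `D_P` (for `D` a domain), expressed inside `D`. -/
def LocallyDvd (P : Ideal D) (a b : D) : Prop :=
  ∃ s ∉ P, a ∣ s * b

namespace LocallyDvd

variable {P : Ideal D} {a b c : D}

theorem of_dvd [hP : P.IsPrime] (h : a ∣ b) : LocallyDvd P a b :=
  ⟨1, P.one_notMem, by simpa using h⟩

theorem of_notMem (h : a ∉ P) (b : D) : LocallyDvd P a b :=
  ⟨a, h, dvd_mul_right a b⟩

theorem trans [hP : P.IsPrime] (h₁ : LocallyDvd P a b) (h₂ : LocallyDvd P b c) :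
    LocallyDvd P a c := by
  obtain ⟨s, hs, hs'⟩ := h₁
  obtain ⟨t, ht, ht'⟩ := h₂
  refine ⟨s * t, hP.mul_notMem hs ht, hs'.trans ?_⟩
  rw [mul_assoc]
  exact mul_dvd_mul_left s ht'

theorem mem [hP : P.IsPrime] (h : LocallyDvd P a b) (ha : a ∈ P) : b ∈ P := by
  obtain ⟨s, hs, hs'⟩ := h
  exact (hP.mem_or_mem (P.mem_of_dvd hs' ha)).resolve_left hs

theorem pow [hP : P.IsPrime] (h : LocallyDvd P a b) (n : ℕ) : LocallyDvd P (a ^ n) (b ^ n) := by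
  obtain ⟨s, hs, hs'⟩ := h
  exact ⟨s ^ n, fun h => hs (hP.mem_of_pow_mem n h), by
    simpa [mul_pow] using pow_dvd_pow_of_dvd hs' n⟩

theorem pow_mul [hP : P.IsPrime] {m : ℕ} (h : LocallyDvd P (a ^ m) (b ^ m)) (n : ℕ) :
    LocallyDvd P (a ^ (m * n)) (b ^ (m * n)) := by
  simpa only [_root_.pow_mul] using h.pow n

end LocallyDvd

/-- The almost valuation property of the localization `D_P`, expressed inside `D`. -/
def IsLocallyAVAt (P : Ideal D) : Prop :=
  ∀ a b : D, ∃ n : ℕ, 1 ≤ n ∧ (LocallyDvd P (a ^ n) (b ^ n) ∨ LocallyDvd P (b ^ n) (a ^ n))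

theorem locallyDvd_iff [IsDomain D] {P : Ideal D} [hP : P.IsPrime] {a b : D} :
    LocallyDvd P a b ↔ algebraMap D (Localization.AtPrime P) a ∣ algebraMap D _ b := by
  have hinj : Function.Injective (algebraMap D (Localization.AtPrime P)) :=
    IsLocalization.injective _ P.primeCompl_le_nonZeroDivisors
  constructor
  · rintro ⟨s, hs, h⟩
    have hu := IsLocalization.map_units (Localization.AtPrime P) (⟨s, hs⟩ : P.primeCompl)
    rw [← hu.dvd_mul_left, ← map_mul]
    exact map_dvd _ h
  · rintro ⟨z, hz⟩
    obtain ⟨⟨c, s⟩, hcs⟩ := IsLocalization.surj P.primeCompl z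
    refine ⟨s, s.2, c, hinj ?_⟩
    rw [map_mul, map_mul, hz, ← hcs]
    ring

theorem isAVDomain_localization_iff [IsDomain D] {P : Ideal D} [hP : P.IsPrime] :
    IsAVDomain (Localization.AtPrime P) ↔ IsLocallyAVAt P := by
  constructor
  · intro h a b
    have hinj : Function.Injective (algebraMap D (Localization.AtPrime P)) :=
      IsLocalization.injective _ P.primeCompl_le_nonZeroDivisors
    rcases eq_or_ne a 0 with rfl | ha
    · exact ⟨1, le_rfl, Or.inr (.of_dvd (by simp))⟩
    rcases eq_or_ne b 0 with rfl | hb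
    · exact ⟨1, le_rfl, Or.inl (.of_dvd (by simp))⟩
    obtain ⟨n, hn, h'⟩ := h.2 (algebraMap D _ a) (algebraMap D _ b)
      (fun h0 => ha (hinj (by simpa using h0))) (fun h0 => hb (hinj (by simpa using h0)))
    exact ⟨n, hn, by simpa only [locallyDvd_iff, map_pow] using h'⟩
  · intro h
    refine ⟨IsLocalization.isDomain_localization P.primeCompl_le_nonZeroDivisors, ?_⟩
    intro x y _ _
    -- Up to units, `x` and `y` are elements of `D`.
    obtain ⟨⟨a, s⟩, ha⟩ := IsLocalization.surj P.primeCompl x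
    obtain ⟨⟨b, t⟩, hb⟩ := IsLocalization.surj P.primeCompl y
    have hs := IsLocalization.map_units (Localization.AtPrime P) s
    have ht := IsLocalization.map_units (Localization.AtPrime P) t
    obtain ⟨n, hn, h'⟩ := h a b
    refine ⟨n, hn, ?_⟩
    simp only [locallyDvd_iff, map_pow] at h'
    dsimp only at ha hb
    rwa [← ha, ← hb, mul_pow, mul_pow, (hs.pow n).mul_right_dvd, (ht.pow n).dvd_mul_right,
      (ht.pow n).mul_right_dvd, (hs.pow n).dvd_mul_right] at h'

/-- In an almost valuation domain finitely many elements become totally ordered by divisibility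
after raising them to a common power; in particular one of the powers divides all the others. -/
theorem IsLocallyAVAt.exists_forall_locallyDvd {P : Ideal D} [hP : P.IsPrime] (h : IsLocallyAVAt P)
    {ι : Type*} (b : ι → D) {S : Finset ι} (hS : S.Nonempty) :
    ∃ n : ℕ, 1 ≤ n ∧ ∃ j ∈ S, ∀ i ∈ S, LocallyDvd P (b j ^ n) (b i ^ n) := by
  classical
  induction hS using Finset.Nonempty.cons_induction with
  | singleton i => exact ⟨1, le_rfl, i, by simp, by simpa using .of_dvd dvd_rfl⟩
  | cons i S hi hS ih =>
    obtain ⟨n, hn, j, hj, hjS⟩ := ih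
    obtain ⟨m, hm, hij⟩ := h (b j) (b i)
    refine ⟨m * n, Nat.mul_pos hm hn, ?_⟩
    rcases hij with hji | hij
    · refine ⟨j, Finset.mem_cons_of_mem hj, fun k hk => ?_⟩
      rcases Finset.mem_cons.1 hk with rfl | hk
      · exact hji.pow_mul n
      · rw [mul_comm]
        exact (hjS k hk).pow_mul m
    · refine ⟨i, Finset.mem_cons_self _ _, fun k hk => ?_⟩
      rcases Finset.mem_cons.1 hk with rfl | hk
      · exact .of_dvd dvd_rfl
      · refine (hij.pow_mul n).trans ?_
        rw [mul_comm]
        exact (hjS k hk).pow_mul m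

end

/-! ### Star-invertibility -/

section

variable {D : Type*} [CommRing D] [IsDomain D]
  {K : Type*} [Field K] [Algebra D K] [IsFractionRing D K]

namespace StarOperation

variable {star : StarOperation D K}

theorem mul_inv_coeIdeal_ne_zero {A : Ideal D} (hA : A ≠ ⊥) :
    (A : FractionalIdeal D⁰ K) * (A : FractionalIdeal D⁰ K)⁻¹ ≠ 0 := fun h =>
  FractionalIdeal.coeIdeal_ne_zero.2 hA
    (le_bot_iff.1 (h ▸ FractionalIdeal.coe_ideal_le_self_mul_inv K A))

/-- Under finite character an integral ideal is `∗`-invertible if and only if it is nonzero and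
principal in `D_P` for every maximal `∗`-ideal `P`, with a generator taken from the ideal and a
common denominator. -/
theorem isInvertible_iff (hstar : star.IsFiniteCharacter) {A : Ideal D} :
    star.IsInvertible (A : FractionalIdeal D⁰ K) ↔
      A ≠ ⊥ ∧ ∀ P ∈ star.maxSpec, ∃ a ∈ A, ∃ s ∉ P.asIdeal, ∀ x ∈ A, a ∣ s * x := by
  have hle : (A : FractionalIdeal D⁰ K) * (A : FractionalIdeal D⁰ K)⁻¹ ≤ 1 := by
    rw [FractionalIdeal.inv_eq]
    exact FractionalIdeal.mul_one_div_le_one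
  obtain ⟨J, hJ⟩ := FractionalIdeal.le_one_iff_exists_coeIdeal.1 hle
  have hinv : star.IsInvertible (A : FractionalIdeal D⁰ K) ↔ star.closure J = ⊤ := by
    rw [IsInvertible, ← hJ, ← coe_closure, FractionalIdeal.coeIdeal_eq_one, Ideal.one_eq_top]
  rw [hinv]
  constructor
  · intro htop
    have hA : A ≠ ⊥ := by
      rintro rfl
      rw [FractionalIdeal.coeIdeal_bot, zero_mul, FractionalIdeal.coeIdeal_eq_zero] at hJ
      rw [hJ, closure_bot] at htop
      exact bot_ne_top htop
    refine ⟨hA, fun P hP => ?_⟩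
    -- `A * A⁻¹` is not contained in `P`, so one of its generators `a * u` is not in `P`.
    by_contra! hcon
    have hJP : J ≤ P.asIdeal := by
      rw [← FractionalIdeal.coeIdeal_le_coeIdeal K, hJ, FractionalIdeal.mul_le]
      rintro _ ⟨a, ha, rfl⟩ u hu
      have hu' : ∀ x ∈ A, ∃ y : D, algebraMap D K y = u * algebraMap D K x := by
        intro x hx
        rw [FractionalIdeal.mem_inv_iff (FractionalIdeal.coeIdeal_ne_zero.2 hA)] at hu
        exact (FractionalIdeal.mem_one_iff D⁰).1
          (hu _ ((FractionalIdeal.mem_coeIdeal D⁰).2 ⟨x, hx, rfl⟩))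
      obtain ⟨s, hs⟩ := hu' a ha
      by_cases hsP : s ∈ P.asIdeal
      · exact (FractionalIdeal.mem_coeIdeal D⁰).2 ⟨s, hsP, by rw [hs, mul_comm]; rfl⟩
      · obtain ⟨x, hx, hnd⟩ := hcon a ha s hsP
        obtain ⟨y, hy⟩ := hu' x hx
        refine absurd ⟨y, IsFractionRing.injective D K ?_⟩ hnd
        rw [map_mul, map_mul, hs, hy]
        ring
    have := closure_le_of_mem_maxSpec hP hJP
    rw [htop] at this
    exact P.2.ne_top (top_le_iff.1 this)
  · rintro ⟨hA, h⟩
    have hAJ : J ≠ ⊥ := by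
      rw [← FractionalIdeal.coeIdeal_ne_zero (K := K), hJ]
      exact mul_inv_coeIdeal_ne_zero hA
    refine closure_eq_top_of_forall_maxSpec hstar hAJ fun P hP hJP => ?_
    obtain ⟨a, ha, s, hs, hdvd⟩ := h P hP
    have ha0 : a ≠ 0 := by
      rintro rfl
      obtain ⟨x, hx, hx0⟩ := Submodule.exists_mem_ne_zero_of_ne_bot hA
      have := hdvd x hx
      rw [zero_dvd_iff, mul_eq_zero, or_iff_left hx0] at this
      exact hs (this ▸ P.asIdeal.zero_mem)
    have ha' : algebraMap D K a ≠ 0 := by simpa using ha0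
    -- The element `s / a` lies in `A⁻¹`, so `s` lies in `A * A⁻¹`.
    have hu : algebraMap D K s / algebraMap D K a ∈ (A : FractionalIdeal D⁰ K)⁻¹ := by
      rw [FractionalIdeal.mem_inv_iff (FractionalIdeal.coeIdeal_ne_zero.2 hA)]
      rintro _ ⟨x, hx, rfl⟩
      obtain ⟨y, hy⟩ := hdvd x hx
      refine (FractionalIdeal.mem_one_iff D⁰).2 ⟨y, ?_⟩
      rw [Algebra.linearMap_apply, div_mul_eq_mul_div, eq_div_iff ha', ← map_mul, ← map_mul, hy,
        mul_comm]
    have hs' : algebraMap D K s ∈ (J : FractionalIdeal D⁰ K) := by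
      rw [hJ]
      have := FractionalIdeal.mul_mem_mul ((FractionalIdeal.mem_coeIdeal D⁰).2 ⟨a, ha, rfl⟩) hu
      rwa [mul_div_cancel₀ _ ha'] at this
    obtain ⟨s₁, hs₁, heq⟩ := (FractionalIdeal.mem_coeIdeal D⁰).1 hs'
    exact hs (IsFractionRing.injective D K heq ▸ hJP hs₁)

theorem isFinitelyInvertible_iff (hstar : star.IsFiniteCharacter) {A : Ideal D} (hA : A ≠ ⊥) :
    star.IsFinitelyInvertible (A : FractionalIdeal D⁰ K) ↔
      star.IsInvertible (A : FractionalIdeal D⁰ K) := by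
  rw [IsFinitelyInvertible, IsInvertible, ← hstar _ (mul_inv_coeIdeal_ne_zero hA)]
  exact ⟨fun h => SetLike.ext (Set.ext_iff.1 h), fun h => by rw [h]⟩

/-- A local generator of an ideal is a local generator of its closure. -/
theorem dvd_mul_of_mem_closure {A : Ideal D} {a s : D} (h : ∀ x ∈ A, a ∣ s * x) {x : D}
    (hx : x ∈ star.closure A) : a ∣ s * x := by
  rw [← Ideal.mem_span_singleton]
  exact mul_mem_of_mem_closure (star.closure_span_singleton a)
    (fun y hy => Ideal.mem_span_singleton.2 (h y hy)) hx

/-- In a local ring, a principal ideal is generated by one of any given generators.  Here the local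
ring is `D_P`, and the ideal is generated by the family `g`. -/
theorem exists_generator_dvd {ι : Type*} {P : Ideal D} [hP : P.IsPrime] {g : ι → D} {c s : D}
    (hne : Ideal.span (Set.range g) ≠ ⊥) (hc : c ∈ Ideal.span (Set.range g)) (hs : s ∉ P)
    (h : ∀ x ∈ Ideal.span (Set.range g), c ∣ s * x) :
    ∃ i, ∀ x ∈ Ideal.span (Set.range g), LocallyDvd P (g i) x := by
  have hc0 : c ≠ 0 := by
    rintro rfl
    refine hne (eq_bot_iff.2 fun x hx => ?_)
    have := h x hx
    rw [zero_dvd_iff, mul_eq_zero] at this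
    exact this.resolve_left fun h0 => hs (h0 ▸ P.zero_mem)
  have hi : ∃ i, ∃ y ∉ P, s * g i = c * y := by
    by_contra! hcon
    -- Otherwise `s * c ∈ c * P`, that is `s ∈ P`.
    have hle : Ideal.span (Set.range g) ≤
        Submodule.comap (LinearMap.mulRight D s) (Ideal.span {c} * P) := by
      rw [Ideal.span_le]
      rintro _ ⟨i, rfl⟩
      obtain ⟨y, hy⟩ := h (g i) (Ideal.subset_span ⟨i, rfl⟩)
      have hyP : y ∈ P := by
        by_contra hyP
        exact hcon i y hyP hy
      exact Ideal.mem_span_singleton_mul.2 ⟨y, hyP, by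
        rw [← hy, LinearMap.mulRight_apply, mul_comm]⟩
    obtain ⟨p, hp, hcp⟩ := Ideal.mem_span_singleton_mul.1 (hle hc)
    rw [LinearMap.mulRight_apply] at hcp
    exact hs (mul_left_cancel₀ hc0 hcp ▸ hp)
  obtain ⟨i, y, hy, hiy⟩ := hi
  refine ⟨i, fun x hx => ?_⟩
  obtain ⟨z, hz⟩ := h x hx
  exact ⟨y * s, hP.mul_notMem hy hs, s * z, by rw [mul_assoc, hz]; linear_combination -z * hiy⟩

end StarOperation

end

/-! ### Height-one primes -/

section

variable {D : Type*} [CommRing D] [IsDomain D]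

theorem eq_of_le_of_mem_heightOnePrimes {P : PrimeSpectrum D} (hP : P ∈ heightOnePrimes D)
    {N : Ideal D} (hN : N.IsPrime) (hN0 : N ≠ ⊥) (h : N ≤ P.asIdeal) : N = P.asIdeal := by
  by_contra hne
  have hP : P.asIdeal.height = 1 := hP
  have : P.asIdeal.FiniteHeight := ⟨Or.inr (by rw [hP]; exact ENat.one_ne_top)⟩
  have : N.FiniteHeight := Ideal.finiteHeight_of_le h P.2.ne_top
  have hlt := Ideal.height_strict_mono_of_isPrime (lt_of_le_of_ne h hne)
  rw [hP, Order.lt_one_iff] at hlt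
  exact hN0 (Ideal.height_eq_zero_iff_eq_bot.1 hlt)

theorem mem_heightOnePrimes_of_forall {P : PrimeSpectrum D} (hP : P.asIdeal ≠ ⊥)
    (h : ∀ N : Ideal D, N.IsPrime → N ≠ ⊥ → N ≤ P.asIdeal → N = P.asIdeal) :
    P ∈ heightOnePrimes D := by
  refine le_antisymm ?_ (Order.one_le_iff_pos.2 (pos_iff_ne_zero.2 fun h0 =>
    hP (Ideal.height_eq_zero_iff_eq_bot.1 h0)))
  refine Ideal.height_le_iff.2 fun N hN hlt => ?_
  by_cases hN0 : N = ⊥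
  · simp [hN0, Ideal.height_bot]
  · exact absurd (h N hN hN0 hlt.le) hlt.ne

theorem isIndependentFamily_heightOnePrimes : IsIndependentFamily (heightOnePrimes D) := by
  rintro P hP Q hQ hne ⟨N, hN, hN0, hNP, hNQ⟩
  exact hne (PrimeSpectrum.ext ((eq_of_le_of_mem_heightOnePrimes hP hN hN0 hNP).symm.trans
    (eq_of_le_of_mem_heightOnePrimes hQ hN hN0 hNQ)))

/-- The ideal `x D_P ∩ D` of the elements that `x` divides in `D_P`. -/
def locallyDvdIdeal (P : Ideal D) [P.IsPrime] (x : D) : Ideal D :=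
  (Ideal.span {algebraMap D (Localization.AtPrime P) x}).comap (algebraMap D _)

theorem mem_locallyDvdIdeal {P : Ideal D} [P.IsPrime] {x y : D} :
    y ∈ locallyDvdIdeal P x ↔ LocallyDvd P x y := by
  rw [locallyDvdIdeal, Ideal.mem_comap, Ideal.mem_span_singleton, locallyDvd_iff]

/-- On a finitely generated ideal, divisibility by `x` in `D_P` has a common denominator. -/
theorem exists_common_denominator {P : Ideal D} [hP : P.IsPrime] {x : D} {B : Ideal D}
    (hB : B.FG) (h : B ≤ locallyDvdIdeal P x) : ∃ s ∉ P, ∀ y ∈ B, x ∣ s * y := by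
  induction B, hB using Submodule.fg_induction with
  | singleton b =>
    obtain ⟨s, hs, hsb⟩ := mem_locallyDvdIdeal.1 (h (Submodule.mem_span_singleton_self b))
    refine ⟨s, hs, fun y hy => ?_⟩
    obtain ⟨c, rfl⟩ := Submodule.mem_span_singleton.1 hy
    rw [smul_eq_mul, mul_left_comm]
    exact hsb.mul_left c
  | sup B₁ B₂ _ _ h₁ h₂ =>
    obtain ⟨s, hs, hs'⟩ := h₁ (le_sup_left.trans h)
    obtain ⟨t, ht, ht'⟩ := h₂ (le_sup_right.trans h)
    refine ⟨s * t, hP.mul_notMem hs ht, fun y hy => ?_⟩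
    obtain ⟨y₁, hy₁, y₂, hy₂, rfl⟩ := Submodule.mem_sup.1 hy
    rw [mul_add, mul_right_comm s t y₁, mul_assoc s t y₂]
    exact dvd_add ((hs' _ hy₁).mul_right t) ((ht' _ hy₂).mul_left s)

/-- If `P` has height one, then `P D_P` is the only prime of `D_P` that contains a given nonzero
`x ∈ P`, so `P D_P` is the radical of `x D_P`. -/
theorem le_radical_locallyDvdIdeal {P : PrimeSpectrum D} (hP : P ∈ heightOnePrimes D) {x : D}
    (hx : x ≠ 0) : P.asIdeal ≤ (locallyDvdIdeal P.asIdeal x).radical := by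
  intro a ha
  rw [locallyDvdIdeal, ← Ideal.comap_radical, Ideal.mem_comap, Ideal.radical_eq_sInf,
    Ideal.mem_sInf]
  rintro q ⟨hxq, hq⟩
  have hxq' : x ∈ Ideal.comap (algebraMap D (Localization.AtPrime P.asIdeal)) q :=
    Ideal.mem_comap.2 (hxq (Ideal.mem_span_singleton_self (algebraMap D _ x)))
  have hle : q.comap (algebraMap D (Localization.AtPrime P.asIdeal)) ≤ P.asIdeal := by
    intro y hy
    by_contra hyP
    exact hq.ne_top (Ideal.eq_top_of_isUnit_mem _ hy
      (IsLocalization.map_units _ (⟨y, hyP⟩ : P.asIdeal.primeCompl)))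
  have := eq_of_le_of_mem_heightOnePrimes hP (hq.comap _)
    (fun h => hx (by rwa [h, Ideal.mem_bot] at hxq')) hle
  rw [← this] at ha
  exact ha

theorem exists_pow_dvd_of_mem_heightOnePrimes {P : PrimeSpectrum D} (hP : P ∈ heightOnePrimes D)
    {x : D} (hx : x ≠ 0) {B : Ideal D} (hB : B.FG) (hBP : B ≤ P.asIdeal) :
    ∃ n : ℕ, ∃ s ∉ P.asIdeal, ∀ y ∈ B ^ n, x ∣ s * y := by
  obtain ⟨n, hn⟩ := Ideal.exists_pow_le_of_le_radical_of_fg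
    (hBP.trans (le_radical_locallyDvdIdeal hP hx)) hB
  exact ⟨n, exists_common_denominator (hB.pow) hn⟩

/-- If no nonzero prime is contained in both `P` and `Q`, then for `x ≠ 0` the ideal `x D_P ∩ D` is
not contained in `Q`. -/
theorem exists_locallyDvd_notMem {P Q : Ideal D} [hP : P.IsPrime] [hQ : Q.IsPrime]
    (h : ¬ ∃ N : Ideal D, N.IsPrime ∧ N ≠ ⊥ ∧ N ≤ P ∧ N ≤ Q) {x : D} (hx : x ≠ 0) :
    ∃ t ∉ Q, LocallyDvd P x t := by
  by_contra! hcon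
  obtain ⟨N, hN, hxN, hdisj⟩ := Ideal.exists_le_prime_disjoint (Ideal.span {x})
    (P.primeCompl ⊔ Q.primeCompl) <| by
      rw [Set.disjoint_left]
      intro y hy hy'
      obtain ⟨s, hs, t, ht, rfl⟩ := Submonoid.mem_sup.1 hy'
      exact hcon t ht ⟨s, hs, Ideal.mem_span_singleton.1 hy⟩
  refine h ⟨N, hN, ?_, fun y hy => ?_, fun y hy => ?_⟩
  · rintro rfl
    exact hx (hxN (Ideal.mem_span_singleton_self x))
  · by_contra hyP
    exact Set.disjoint_left.1 hdisj hy ((le_sup_left : _ ≤ P.primeCompl ⊔ Q.primeCompl) hyP)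
  · by_contra hyP
    exact Set.disjoint_left.1 hdisj hy ((le_sup_right : _ ≤ P.primeCompl ⊔ Q.primeCompl) hyP)

/-- For a multiplicative set of ideals, the ideal of the `y` such that `y M ⊆ (x)` for some member
`M`. -/
def prodColon (prods : Submonoid (Ideal D)) (x : D) : Ideal D where
  carrier := {y | ∃ M ∈ prods, ∀ z ∈ M, x ∣ y * z}
  zero_mem' := by
    refine Set.mem_ofPred.2 ⟨1, prods.one_mem, fun z _ => ?_⟩
    rw [zero_mul]
    exact dvd_zero x
  add_mem' := by
    intro y₁ y₂ hy₁ hy₂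
    obtain ⟨M₁, hM₁, h₁⟩ := Set.mem_ofPred.1 hy₁
    obtain ⟨M₂, hM₂, h₂⟩ := Set.mem_ofPred.1 hy₂
    refine Set.mem_ofPred.2 ⟨M₁ * M₂, mul_mem hM₁ hM₂, fun z hz => ?_⟩
    rw [add_mul]
    have hz₁ : z ∈ M₁ := (Ideal.mul_le_left : M₁ * M₂ ≤ M₁) hz
    have hz₂ : z ∈ M₂ := (Ideal.mul_le_right : M₁ * M₂ ≤ M₂) hz
    exact dvd_add (h₁ z hz₁) (h₂ z hz₂)
  smul_mem' := by
    intro c y hy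
    obtain ⟨M, hM, h⟩ := Set.mem_ofPred.1 hy
    refine Set.mem_ofPred.2 ⟨M, hM, fun z hz => ?_⟩
    rw [smul_eq_mul, mul_assoc]
    exact (h z hz).mul_left c

end

section

variable {D : Type*} [CommRing D] [IsDomain D]
  {K : Type*} [Field K] [Algebra D K] [IsFractionRing D K]

namespace StarOperation

variable {star : StarOperation D K} {P Q : PrimeSpectrum D}

/-- Height-one primes are `∗`-ideals: for a finitely generated `B ⊆ P` and `0 ≠ x ∈ P` some
multiple `s B ^ n` with `s ∉ P` lies in `(x)`, hence so does `s (B_∗) ^ n`. -/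
theorem closure_eq_of_mem_heightOnePrimes (hstar : star.IsFiniteCharacter)
    (hP : P ∈ heightOnePrimes D) : star.closure P.asIdeal = P.asIdeal := by
  refine le_antisymm (fun y hy => ?_) (star.le_closure _)
  obtain ⟨B, hB, hBP, hyB⟩ := exists_fg_of_mem_closure hstar hy
  obtain ⟨x, hxP, hx⟩ := Submodule.exists_mem_ne_zero_of_ne_bot (Ideal.ne_bot_of_height_eq_one hP)
  obtain ⟨n, s, hs, hdvd⟩ := exists_pow_dvd_of_mem_heightOnePrimes hP hx hB hBP
  have h := dvd_mul_of_mem_closure hdvd (closure_pow_le B n (Ideal.pow_mem_pow hyB n))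
  have hmem := (P.2.mem_or_mem (P.asIdeal.mem_of_dvd h hxP)).resolve_left hs
  exact P.2.mem_of_pow_mem n hmem

theorem maxSpec_eq_heightOnePrimes (hstar : star.IsFiniteCharacter)
    (h : star.maxSpec ⊆ heightOnePrimes D) : star.maxSpec = heightOnePrimes D := by
  refine h.antisymm fun Q hQ => ?_
  have hQ0 := Ideal.ne_bot_of_height_eq_one hQ
  obtain ⟨P, hP, hQP⟩ := exists_le_maxSpec hstar hQ0 (by
    rw [closure_eq_of_mem_heightOnePrimes hstar hQ]
    exact Q.2.ne_top)
  rwa [PrimeSpectrum.ext (eq_of_le_of_mem_heightOnePrimes (h hP) Q.2 hQ0 hQP)]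

/-! ### Homogeneous ideals -/

theorem IsHomogeneousAt.not_le {A : Ideal D} (hA : star.IsHomogeneousAt P A)
    (hQ : Q ∈ star.maxSpec) (hne : Q ≠ P) : ¬ A ≤ Q.asIdeal :=
  fun h => hne (hA.2.2.2.2 Q hQ h)

theorem IsHomogeneousAt.unique {A : Ideal D} (hA : star.IsHomogeneousAt P A)
    (hA' : star.IsHomogeneousAt Q A) : Q = P :=
  hA.2.2.2.2 Q hA'.2.2.1 hA'.2.2.2.1

/-- At a maximal `∗`-ideal of height one all homogeneous ideals have type 1: every `p ∈ P` has a
power that lies in `A_∗` locally at `P`, and the other maximal `∗`-ideals do not contain `A`. -/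
theorem IsHomogeneousAt.isTypeOne (hstar : star.IsFiniteCharacter) {A : Ideal D}
    (hA : star.IsHomogeneousAt P A) (hP : P ∈ heightOnePrimes D) :
    P.asIdeal = (star.closure A).radical := by
  refine le_antisymm (fun p hp => ?_) ?_
  · obtain ⟨x, hxA, hx⟩ := Submodule.exists_mem_ne_zero_of_ne_bot hA.1
    obtain ⟨n, hn⟩ := le_radical_locallyDvdIdeal hP hx hp
    obtain ⟨s, hs, hdvd⟩ := mem_locallyDvdIdeal.1 hn
    refine ⟨n, mem_closure_of_forall_maxSpec hstar hA.1 fun Q hQ => ?_⟩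
    by_cases hQP : Q = P
    · exact ⟨s, hQP ▸ hs, star.le_closure A (A.mem_of_dvd hdvd hxA)⟩
    · obtain ⟨t, htA, htQ⟩ := SetLike.not_le_iff_exists.1 (hA.not_le hQ hQP)
      exact ⟨t, htQ, star.le_closure A (A.mul_mem_right _ htA)⟩
  · exact P.2.radical_le_iff.2 (closure_le_of_mem_maxSpec hA.2.2.1 hA.2.2.2.1)

/-- A criterion for invertibility that tests only the maximal `∗`-ideals containing the ideal. -/
theorem isInvertible_of_forall (hstar : star.IsFiniteCharacter) {A : Ideal D} (hA : A ≠ ⊥)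
    (h : ∀ P ∈ star.maxSpec, A ≤ P.asIdeal → ∃ a ∈ A, ∃ s ∉ P.asIdeal, ∀ x ∈ A, a ∣ s * x) :
    star.IsInvertible (A : FractionalIdeal D⁰ K) := by
  refine (isInvertible_iff hstar).2 ⟨hA, fun P hP => ?_⟩
  by_cases hAP : A ≤ P.asIdeal
  · exact h P hP hAP
  · obtain ⟨a, ha, haP⟩ := SetLike.not_le_iff_exists.1 hAP
    exact ⟨a, ha, a, haP, fun x _ => dvd_mul_right a x⟩

/-- Under local finiteness any nonzero `x ∈ P` generates a homogeneous ideal at `P` together with,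
for each of the finitely many other maximal `∗`-ideals `Q` that contain `x`, one element `t Q` of `P`
outside `Q`.  (The element `t P` may be any element of `P`.) -/
theorem isHomogeneousAt_span (hfin : IsLocallyFiniteFamily star.maxSpec) (hP : P ∈ star.maxSpec)
    {x : D} (hx : x ≠ 0) (hxP : x ∈ P.asIdeal) {t : PrimeSpectrum D → D}
    (ht : ∀ Q ∈ star.maxSpec, t Q ∈ P.asIdeal)
    (htQ : ∀ Q ∈ star.maxSpec, Q ≠ P → t Q ∉ Q.asIdeal) :
    star.IsHomogeneousAt P
      (Ideal.span (insert x (t '' {Q ∈ star.maxSpec | x ∈ Q.asIdeal}))) := by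
  have hT := hfin x hx fun hu => P.2.ne_top (Ideal.eq_top_of_isUnit_mem _ hxP hu)
  set B : Ideal D := Ideal.span (insert x (t '' {Q ∈ star.maxSpec | x ∈ Q.asIdeal})) with hBdef
  have hxB : x ∈ B := Ideal.subset_span (Set.mem_insert _ _)
  refine ⟨fun h => hx (by rwa [h, Ideal.mem_bot] at hxB),
    Submodule.fg_span ((hT.image t).insert x), hP, ?_, fun Q hQ hBQ => ?_⟩
  · rw [hBdef, Ideal.span_le]
    rintro _ (rfl | ⟨Q, hQ, rfl⟩)
    · exact hxP
    · exact ht Q hQ.1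
  · by_contra hne
    exact htQ Q hQ hne (hBQ (Ideal.subset_span
      (Set.mem_insert_of_mem _ ⟨Q, ⟨hQ, hBQ hxB⟩, rfl⟩)))

/-- Under independence and local finiteness there is a `∗`-invertible homogeneous ideal `B` at `P`
with `x ∈ B ⊆ x D_P ∩ D`: by independence the further generators of a homogeneous ideal that
contains `x` can be taken from `x D_P ∩ D`. -/
theorem exists_isHomogeneousAt (hstar : star.IsFiniteCharacter)
    (hind : IsIndependentFamily star.maxSpec) (hfin : IsLocallyFiniteFamily star.maxSpec)
    (hP : P ∈ star.maxSpec) {x : D} (hx : x ≠ 0) (hxP : x ∈ P.asIdeal) :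
    ∃ B : Ideal D, star.IsHomogeneousAt P B ∧ star.IsInvertible (B : FractionalIdeal D⁰ K) ∧
      x ∈ B ∧ ∃ s ∉ P.asIdeal, ∀ b ∈ B, x ∣ s * b := by
  have hex : ∀ Q ∈ star.maxSpec, ∃ t, LocallyDvd P.asIdeal x t ∧ (Q ≠ P → t ∉ Q.asIdeal) := by
    intro Q hQ
    by_cases hQP : Q = P
    · exact ⟨x, .of_dvd dvd_rfl, fun h => absurd hQP h⟩
    · obtain ⟨t, ht, hxt⟩ := exists_locallyDvd_notMem (hind P hP Q hQ (Ne.symm hQP)) hx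
      exact ⟨t, hxt, fun _ => ht⟩
  choose! t ht htQ using hex
  have hB := isHomogeneousAt_span hfin hP hx hxP (fun Q hQ => (ht Q hQ).mem hxP) htQ
  set B : Ideal D := Ideal.span (insert x (t '' {Q ∈ star.maxSpec | x ∈ Q.asIdeal})) with hBdef
  have hxB : x ∈ B := Ideal.subset_span (Set.mem_insert _ _)
  have hBloc : B ≤ locallyDvdIdeal P.asIdeal x := by
    rw [hBdef, Ideal.span_le]
    rintro _ (rfl | ⟨Q, hQ, rfl⟩)
    · exact mem_locallyDvdIdeal.2 (.of_dvd dvd_rfl)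
    · exact mem_locallyDvdIdeal.2 (ht Q hQ.1)
  obtain ⟨s, hs, hsB⟩ := exists_common_denominator hB.2.1 hBloc
  refine ⟨B, hB, ?_, hxB, s, hs, hsB⟩
  refine isInvertible_of_forall hstar hB.1 fun Q hQ hBQ => ?_
  rw [hB.2.2.2.2 Q hQ hBQ]
  exact ⟨x, hxB, s, hs, hsB⟩

theorem isPotent_of_isLocallyFiniteFamily (hfin : IsLocallyFiniteFamily star.maxSpec) :
    star.IsPotent := by
  intro P hP
  obtain ⟨x, hxP, hx⟩ := Submodule.exists_mem_ne_zero_of_ne_bot (ne_bot_of_mem_maxSpec hP)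
  have hex : ∀ Q ∈ star.maxSpec, ∃ t ∈ P.asIdeal, Q ≠ P → t ∉ Q.asIdeal := by
    intro Q hQ
    by_cases hQP : Q = P
    · exact ⟨x, hxP, fun h => absurd hQP h⟩
    · obtain ⟨t, ht, htQ⟩ := SetLike.not_le_iff_exists.1
        (fun h => hQP (eq_of_le_of_mem_maxSpec hP hQ h).symm)
      exact ⟨t, ht, fun _ => htQ⟩
  choose! t ht htQ using hex
  have hB := isHomogeneousAt_span hfin hP hx hxP ht htQ
  exact ⟨_, ⟨P, hB⟩, hB.2.2.2.1⟩

/-- Potency gives local finiteness when all maximal `∗`-ideals have height one.  For `x ≠ 0`, the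
elements `y` such that `y` times some finite product of homogeneous ideals lies in `(x)` form a
`∗`-ideal that lies in no maximal `∗`-ideal.  So a product of homogeneous ideals lies in `(x)`, and
every maximal `∗`-ideal containing `x` is attached to one of its factors. -/
theorem isLocallyFiniteFamily_of_isPotent (hstar : star.IsFiniteCharacter) (hpot : star.IsPotent)
    (h1 : star.maxSpec ⊆ heightOnePrimes D) : IsLocallyFiniteFamily star.maxSpec := by
  intro x hx _
  have hex : ∀ P ∈ star.maxSpec, ∃ A : Ideal D, star.IsHomogeneousAt P A := by
    intro P hP
    obtain ⟨A, ⟨P', hA⟩, hAP⟩ := hpot P hP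
    exact ⟨A, hA.2.2.2.2 P hP hAP ▸ hA⟩
  choose! A hA using hex
  set prods : Submonoid (Ideal D) := Submonoid.closure (A '' star.maxSpec)
  set I : Ideal D := prodColon prods x
  have hmem (y : D) : y ∈ I ↔ ∃ M ∈ prods, ∀ z ∈ M, x ∣ y * z := Iff.rfl
  have hxI : x ∈ I := (hmem x).2 ⟨1, one_mem _, fun z _ => dvd_mul_right x z⟩
  have hI0 : I ≠ ⊥ := fun h => hx (by rwa [h, Ideal.mem_bot] at hxI)
  -- A finitely generated part of `I` is multiplied into `(x)` by a single product.
  have hfg : ∀ B : Ideal D, B.FG → B ≤ I → ∃ M ∈ prods, ∀ z ∈ M, ∀ y ∈ B, x ∣ z * y := by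
    intro B hB
    induction B, hB using Submodule.fg_induction with
    | singleton b =>
      intro h
      obtain ⟨M, hM, hb⟩ := (hmem b).1 (h (Submodule.mem_span_singleton_self b))
      refine ⟨M, hM, fun z hz y hy => ?_⟩
      obtain ⟨c, rfl⟩ := Submodule.mem_span_singleton.1 hy
      rw [smul_eq_mul, mul_left_comm, mul_comm z b]
      exact (hb z hz).mul_left c
    | sup B₁ B₂ _ _ h₁ h₂ =>
      intro h
      obtain ⟨M₁, hM₁, h₁⟩ := h₁ (le_sup_left.trans h)
      obtain ⟨M₂, hM₂, h₂⟩ := h₂ (le_sup_right.trans h)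
      refine ⟨M₁ * M₂, mul_mem hM₁ hM₂, fun z hz y hy => ?_⟩
      obtain ⟨y₁, hy₁, y₂, hy₂, rfl⟩ := Submodule.mem_sup.1 hy
      rw [mul_add]
      have hz₁ : z ∈ M₁ := (Ideal.mul_le_left : M₁ * M₂ ≤ M₁) hz
      have hz₂ : z ∈ M₂ := (Ideal.mul_le_right : M₁ * M₂ ≤ M₂) hz
      exact dvd_add (h₁ z hz₁ y₁ hy₁) (h₂ z hz₂ y₂ hy₂)
  have hIcl : star.closure I = I := by
    refine le_antisymm (fun y hy => ?_) (star.le_closure I)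
    obtain ⟨B, hB, hBI, hyB⟩ := exists_fg_of_mem_closure hstar hy
    obtain ⟨M, hM, hdvd⟩ := hfg B hB hBI
    refine (hmem y).2 ⟨M, hM, fun z hz => ?_⟩
    rw [mul_comm]
    exact dvd_mul_of_mem_closure (hdvd z hz) hyB
  have hItop : I = ⊤ := by
    by_contra hne
    obtain ⟨P, hP, hIP⟩ := exists_le_maxSpec hstar hI0 (by rwa [hIcl])
    obtain ⟨n, s, hs, hdvd⟩ := exists_pow_dvd_of_mem_heightOnePrimes (h1 hP) hx (hA P hP).2.1
      (hA P hP).2.2.2.1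
    have hAP : A P ∈ prods := Submonoid.subset_closure (Set.mem_image_of_mem A hP)
    exact hs (hIP ((hmem s).2 ⟨A P ^ n, pow_mem hAP n, hdvd⟩))
  have h1I : (1 : D) ∈ I := by
    rw [hItop]
    exact Submodule.mem_top
  obtain ⟨M, hM, hMx⟩ := (hmem 1).1 h1I
  obtain ⟨l, hl, rfl⟩ := Submonoid.exists_list_of_mem_closure hM
  have hfin : {P ∈ star.maxSpec | A P ∈ l}.Finite := by
    refine Set.Finite.of_finite_image ((List.finite_toSet l).subset ?_) (f := A) ?_
    · rintro _ ⟨P, hP, rfl⟩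
      exact hP.2
    · intro P hP Q hQ hPQ
      have hQ' := hA Q hQ.1
      rw [← hPQ] at hQ'
      exact hQ'.unique (hA P hP.1)
  refine hfin.subset ?_
  rintro P ⟨hP, hxP⟩
  have hle : l.prod ≤ P.asIdeal := fun z hz =>
    P.asIdeal.mem_of_dvd (by simpa using hMx z hz) hxP
  rw [← Multiset.prod_coe, P.2.multiset_prod_le] at hle
  obtain ⟨B, hB, hBP⟩ := hle
  obtain ⟨Q, hQ, rfl⟩ := hl B hB
  rw [(hA Q hQ).2.2.2.2 P hP hBP]
  exact ⟨hQ, hB⟩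

end StarOperation

end

section

variable {D : Type*} [CommRing D] [IsDomain D]
  {K : Type*} [Field K] [Algebra D K] [IsFractionRing D K]

namespace StarOperation

variable {star : StarOperation D K} {P : PrimeSpectrum D}

/-! ### The almost valuation property of the localizations -/

theorem isLocallyAV_iff : star.IsLocallyAV ↔ ∀ P ∈ star.maxSpec, IsLocallyAVAt P.asIdeal :=
  forall₂_congr fun _ _ => isAVDomain_localization_iff

/-- `∗`-invertibility of `(aⁿ, bⁿ)` makes this ideal principal in `D_P`, so that one of the two
generators divides the other there. -/
theorem IsAPMD.isLocallyAV (hstar : star.IsFiniteCharacter) (h : star.IsAPMD) :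
    star.IsLocallyAV := by
  refine isLocallyAV_iff.2 fun P hP a b => ?_
  rcases eq_or_ne a 0 with rfl | ha
  · exact ⟨1, le_rfl, Or.inr (.of_dvd (by simp))⟩
  rcases eq_or_ne b 0 with rfl | hb
  · exact ⟨1, le_rfl, Or.inl (.of_dvd (by simp))⟩
  obtain ⟨n, hn, hinv⟩ := h a b ha hb
  have hrange : ({a ^ n, b ^ n} : Set D) = Set.range ![a ^ n, b ^ n] := by
    rw [Matrix.range_cons_cons_empty]
  have ha' : a ^ n ∈ Ideal.span {a ^ n, b ^ n} := Ideal.subset_span (by simp)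
  have hb' : b ^ n ∈ Ideal.span {a ^ n, b ^ n} := Ideal.subset_span (by simp)
  have hne : Ideal.span {a ^ n, b ^ n} ≠ ⊥ := fun h0 => by
    rw [h0, Ideal.mem_bot] at ha'
    exact ha (eq_zero_of_pow_eq_zero ha')
  obtain ⟨c, hc, s, hs, hdvd⟩ :=
    ((isInvertible_iff hstar).1 ((isFinitelyInvertible_iff hstar hne).1 hinv)).2 P hP
  rw [hrange] at hne hc hdvd ha' hb'
  obtain ⟨i, hi⟩ := exists_generator_dvd hne hc hs hdvd
  refine ⟨n, hn, ?_⟩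
  fin_cases i
  · exact Or.inl (hi _ hb')
  · exact Or.inr (hi _ ha')

/-- By local finiteness the exponents needed at the various maximal `∗`-ideals have a common
multiple. -/
theorem IsLocallyAV.isAPMD (hstar : star.IsFiniteCharacter) (hav : star.IsLocallyAV)
    (hfin : IsLocallyFiniteFamily star.maxSpec) : star.IsAPMD := by
  intro a b ha hb
  have hT : {P ∈ star.maxSpec | a ∈ P.asIdeal}.Finite := by
    by_cases hu : IsUnit a
    · convert Set.finite_empty
      ext P
      simpa using fun _ h => P.2.ne_top (Ideal.eq_top_of_isUnit_mem _ h hu)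
    · exact hfin a ha hu
  have hex := fun P hP => isLocallyAV_iff.1 hav P hP a b
  choose! m hm hdvd using hex
  set n : ℕ := ∏ P ∈ hT.toFinset, m P
  have hn : 1 ≤ n := Nat.succ_le_of_lt
    (Finset.prod_pos fun P hP => Nat.lt_of_succ_le (hm P (hT.mem_toFinset.1 hP).1))
  have ha' : a ^ n ∈ Ideal.span {a ^ n, b ^ n} := Ideal.subset_span (by simp)
  have hb' : b ^ n ∈ Ideal.span {a ^ n, b ^ n} := Ideal.subset_span (by simp)
  have hne : Ideal.span {a ^ n, b ^ n} ≠ ⊥ := fun h0 => by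
    rw [h0, Ideal.mem_bot] at ha'
    exact ha (eq_zero_of_pow_eq_zero ha')
  have hfg : (Ideal.span {a ^ n, b ^ n}).FG := Submodule.fg_span (Set.toFinite _)
  refine ⟨n, hn, (isFinitelyInvertible_iff hstar hne).2
    (isInvertible_of_forall hstar hne fun P hP hle => ?_)⟩
  have haP : a ∈ P.asIdeal := P.2.mem_of_pow_mem n (hle ha')
  obtain ⟨k, hk⟩ : m P ∣ n := Finset.dvd_prod_of_mem m (hT.mem_toFinset.2 ⟨hP, haP⟩)
  rcases hdvd P hP with hab | hba
  · obtain ⟨s, hs, hs'⟩ := exists_common_denominator (P := P.asIdeal) (x := a ^ n) hfg <| by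
      rw [Ideal.span_le]
      rintro _ (rfl | rfl)
      · exact mem_locallyDvdIdeal.2 (.of_dvd dvd_rfl)
      · exact mem_locallyDvdIdeal.2 (hk ▸ hab.pow_mul k)
    exact ⟨_, ha', s, hs, hs'⟩
  · obtain ⟨s, hs, hs'⟩ := exists_common_denominator (P := P.asIdeal) (x := b ^ n) hfg <| by
      rw [Ideal.span_le]
      rintro _ (rfl | rfl)
      · exact mem_locallyDvdIdeal.2 (hk ▸ hba.pow_mul k)
      · exact mem_locallyDvdIdeal.2 (.of_dvd dvd_rfl)
    exact ⟨_, hb', s, hs, hs'⟩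

theorem IsAGKD.isHLocal (h : star.IsAGKD) : star.IsHLocal := by
  rw [IsHLocal, h.2.1]
  exact ⟨h.1.1, isIndependentFamily_heightOnePrimes, h.1.2⟩

theorem IsHLocal.isAGKD (hstar : star.IsFiniteCharacter) (h : star.IsHLocal)
    (hav : star.IsLocallyAV) (h1 : star.maxSpec ⊆ heightOnePrimes D) : star.IsAGKD := by
  have heq := maxSpec_eq_heightOnePrimes hstar h1
  exact ⟨heq ▸ ⟨h.1, h.2.2⟩, heq, hav⟩

/-- Let `N` be a nonzero prime inside a maximal `∗`-ideal `P`.  For `0 ≠ x ∈ N` there is an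
invertible homogeneous ideal `B ⊆ x D_P ∩ D`; then `B_∗ ⊆ N`, and type 1 forces `P ⊆ N`. -/
theorem maxSpec_subset_heightOnePrimes (hstar : star.IsFiniteCharacter) (h : star.IsHLocal)
    (htype : ∀ A : Ideal D, star.IsInvertible (A : FractionalIdeal D⁰ K) →
      star.IsHomogeneous A → star.IsTypeOne A) : star.maxSpec ⊆ heightOnePrimes D := by
  intro P hP
  refine mem_heightOnePrimes_of_forall (ne_bot_of_mem_maxSpec hP) fun N hN hN0 hNP =>
    hNP.antisymm ?_
  obtain ⟨x, hxN, hx⟩ := Submodule.exists_mem_ne_zero_of_ne_bot hN0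
  obtain ⟨B, hB, hBinv, -, s, hs, hdvd⟩ :=
    exists_isHomogeneousAt hstar h.2.1 h.2.2 hP hx (hNP hxN)
  obtain ⟨P', hB', hrad⟩ := htype B hBinv ⟨P, hB⟩
  obtain rfl := hB.unique hB'
  rw [hrad, hN.radical_le_iff]
  intro y hy
  exact (hN.mem_or_mem (N.mem_of_dvd (dvd_mul_of_mem_closure hdvd hy) hxN)).resolve_left
    fun hsN => hs (hNP hsN)

/-! ### Almost super-homogeneous ideals -/

/-- In the presence of the almost valuation property invertible homogeneous ideals are almost
super-homogeneous: at `P` powers of the `bᵢ` with a common exponent are linearly ordered by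
divisibility, and a maximal `∗`-ideal that contains all `bᵢ` contains `A`, so it is `P`. -/
theorem IsLocallyAV.isAlmostSuperHomogeneous (hstar : star.IsFiniteCharacter)
    (hav : star.IsLocallyAV) {A : Ideal D} (hinv : star.IsInvertible (A : FractionalIdeal D⁰ K))
    (hA : star.IsHomogeneousAt P A) : star.IsAlmostSuperHomogeneous A := by
  refine ⟨hinv, P, hA, fun k b hb ⟨r, hr, hle⟩ => ?_⟩
  have hP := hA.2.2.1
  have hb0 : Ideal.span (Set.range b) ≠ ⊥ := fun h0 => by
    rw [h0, closure_bot, le_bot_iff] at hle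
    exact hA.1 (pow_eq_zero_iff (by omega) |>.1 hle)
  have hne : (Finset.univ : Finset (Fin k)).Nonempty := by
    rw [Finset.univ_nonempty_iff]
    by_contra hempty
    rw [not_nonempty_iff] at hempty
    exact hb0 (by rw [Set.range_eq_empty, Ideal.span_empty])
  obtain ⟨n, hn, j, -, hj⟩ := (isLocallyAV_iff.1 hav P hP).exists_forall_locallyDvd b hne
  have hfg : (Ideal.span (Set.range fun i => b i ^ n)).FG := Submodule.fg_span (Set.finite_range _)
  have hmem (i : Fin k) : b i ^ n ∈ Ideal.span (Set.range fun i => b i ^ n) :=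
    Ideal.subset_span ⟨i, rfl⟩
  refine ⟨n, hn, isInvertible_of_forall hstar (fun h0 => hb0 ?_) fun Q hQ hle' => ?_⟩
  · rw [Ideal.span_eq_bot]
    rintro _ ⟨i, rfl⟩
    have := hmem i
    rw [h0, Ideal.mem_bot] at this
    exact eq_zero_of_pow_eq_zero this
  · have hspan : Ideal.span (Set.range b) ≤ Q.asIdeal := by
      rw [Ideal.span_le]
      rintro _ ⟨i, rfl⟩
      exact Q.2.mem_of_pow_mem n (hle' (hmem i))
    have hAQ : A ≤ Q.asIdeal :=
      Q.2.le_of_pow_le (hle.trans (closure_le_of_mem_maxSpec hQ hspan))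
    obtain rfl := hA.2.2.2.2 Q hQ hAQ
    obtain ⟨s, hs, hs'⟩ := exists_common_denominator (P := Q.asIdeal) (x := b j ^ n) hfg <| by
      rw [Ideal.span_le]
      rintro _ ⟨i, rfl⟩
      exact mem_locallyDvdIdeal.2 (hj i (Finset.mem_univ i))
    exact ⟨_, hmem j, s, hs, hs'⟩

theorem IsAGKD.isTypeOneAlmostSuperHomogeneous (hstar : star.IsFiniteCharacter) (h : star.IsAGKD)
    {A : Ideal D} (hinv : star.IsInvertible (A : FractionalIdeal D⁰ K))
    (hA : star.IsHomogeneous A) : star.IsTypeOneAlmostSuperHomogeneous A := by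
  obtain ⟨P, hA⟩ := hA
  exact ⟨h.2.2.isAlmostSuperHomogeneous hstar hinv hA, P, hA,
    hA.isTypeOne hstar (h.2.1 ▸ hA.2.2.1)⟩

/-! ### Star-products of homogeneous ideals -/

/-- In a `∗`-h-local domain the closure of an invertible ideal `A` is a `∗`-product of invertible
homogeneous ideals, one for each of the finitely many maximal `∗`-ideals `P` that contain `A`; the
factor at `P` coincides with `A` in `D_P`. -/
theorem IsHLocal.isStarProductOf (hstar : star.IsFiniteCharacter) (h : star.IsHLocal) {A : Ideal D}
    (hinv : star.IsInvertible (A : FractionalIdeal D⁰ K)) (hA : star.closure A ≠ ⊤) :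
    star.IsStarProductOf
      (fun B => star.IsInvertible (B : FractionalIdeal D⁰ K) ∧ star.IsHomogeneous B)
      (star.closure A) := by
  classical
  obtain ⟨hA0, hloc⟩ := (isInvertible_iff hstar).1 hinv
  obtain ⟨P₀, hP₀, hAP₀⟩ := exists_le_maxSpec hstar hA0 hA
  obtain ⟨x, hxA, hx⟩ := Submodule.exists_mem_ne_zero_of_ne_bot hA0
  have hT : {P ∈ star.maxSpec | A ≤ P.asIdeal}.Finite :=
    (h.2.2 x hx fun hu => P₀.2.ne_top (Ideal.eq_top_of_isUnit_mem _ (hAP₀ hxA) hu)).subset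
      fun P hP => ⟨hP.1, hP.2 hxA⟩
  have hex : ∀ P : PrimeSpectrum D, P ∈ star.maxSpec ∧ A ≤ P.asIdeal → ∃ B : Ideal D,
      star.IsHomogeneousAt P B ∧ star.IsInvertible (B : FractionalIdeal D⁰ K) ∧
        (∀ y ∈ A, ∃ s ∉ P.asIdeal, s * y ∈ B) ∧ (∀ y ∈ B, ∃ s ∉ P.asIdeal, s * y ∈ A) := by
    rintro P ⟨hP, hAP⟩
    obtain ⟨a, ha, s, hs, hdvd⟩ := hloc P hP
    have ha0 : a ≠ 0 := by
      rintro rfl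
      have := hdvd x hxA
      rw [zero_dvd_iff, mul_eq_zero, or_iff_left hx] at this
      exact hs (this ▸ P.asIdeal.zero_mem)
    obtain ⟨B, hB, hBinv, haB, t, ht, hdvd'⟩ :=
      exists_isHomogeneousAt hstar h.2.1 h.2.2 hP ha0 (hAP ha)
    exact ⟨B, hB, hBinv, fun y hy => ⟨s, hs, B.mem_of_dvd (hdvd y hy) haB⟩,
      fun y hy => ⟨t, ht, A.mem_of_dvd (hdvd' y hy) ha⟩⟩
  choose! B hB hBinv hAB hBA using hex
  have hmemT {P : PrimeSpectrum D} : P ∈ hT.toFinset ↔ P ∈ star.maxSpec ∧ A ≤ P.asIdeal :=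
    hT.mem_toFinset
  have hprod : (hT.toFinset.toList.map B).prod = ∏ P ∈ hT.toFinset, B P :=
    Finset.prod_map_toList _ _
  refine ⟨hT.toFinset.toList.map B, ?_, ?_, ?_⟩
  · have : P₀ ∈ hT.toFinset.toList := Finset.mem_toList.2 (hmemT.2 ⟨hP₀, hAP₀⟩)
    intro h0
    rw [List.map_eq_nil_iff] at h0
    simp [h0] at this
  · intro C hC
    obtain ⟨P, hP, rfl⟩ := List.mem_map.1 hC
    have hP' := hmemT.1 (Finset.mem_toList.1 hP)
    exact ⟨hBinv P hP', P, hB P hP'⟩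
  · rw [hprod]
    have hne : ∏ P ∈ hT.toFinset, B P ≠ ⊥ := by
      rw [← Ideal.zero_eq_bot, Finset.prod_ne_zero_iff]
      exact fun P hP => (hB P (hmemT.1 hP)).1
    apply le_antisymm
    · rw [← star.closure_closure (∏ P ∈ hT.toFinset, B P)]
      refine star.closure_mono fun y hy => mem_closure_of_forall_maxSpec hstar hne fun P hP => ?_
      by_cases hAP : A ≤ P.asIdeal
      · -- At `P` only the factor `B P` matters.
        have hrest : ¬ ∏ Q ∈ hT.toFinset.erase P, B Q ≤ P.asIdeal := by
          rw [P.2.prod_le]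
          rintro ⟨Q, hQ, hle⟩
          obtain ⟨hne', hQ⟩ := Finset.mem_erase.1 hQ
          exact hne' ((hB Q (hmemT.1 hQ)).2.2.2.2 P hP hle).symm
        obtain ⟨t, ht, htP⟩ := SetLike.not_le_iff_exists.1 hrest
        obtain ⟨s, hs, hsy⟩ := hAB P ⟨hP, hAP⟩ y hy
        refine ⟨s * t, P.2.mul_notMem hs htP, star.le_closure _ ?_⟩
        rw [← Finset.mul_prod_erase _ _ (hmemT.2 ⟨hP, hAP⟩), mul_right_comm]
        exact Ideal.mul_mem_mul hsy ht
      · have hnot : ¬ ∏ Q ∈ hT.toFinset, B Q ≤ P.asIdeal := by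
          rw [P.2.prod_le]
          rintro ⟨Q, hQ, hle⟩
          have hQ' := hmemT.1 hQ
          exact hAP ((hB Q hQ').2.2.2.2 P hP hle ▸ hQ'.2)
        obtain ⟨t, ht, htP⟩ := SetLike.not_le_iff_exists.1 hnot
        exact ⟨t, htP, star.le_closure _ (Ideal.mul_mem_right _ _ ht)⟩
    · rw [← star.closure_closure A]
      refine star.closure_mono fun y hy => mem_closure_of_forall_maxSpec hstar hA0 fun P hP => ?_
      by_cases hAP : A ≤ P.asIdeal
      · have hyB : y ∈ B P :=
          (Ideal.prod_le_inf.trans (Finset.inf_le (hmemT.2 ⟨hP, hAP⟩))) hy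
        obtain ⟨s, hs, hsy⟩ := hBA P ⟨hP, hAP⟩ y hyB
        exact ⟨s, hs, star.le_closure A hsy⟩
      · obtain ⟨a, ha, haP⟩ := SetLike.not_le_iff_exists.1 hAP
        exact ⟨a, haP, star.le_closure A (A.mul_mem_right _ ha)⟩

theorem isInvertible_span_singleton (hstar : star.IsFiniteCharacter) {x : D} (hx : x ≠ 0) :
    star.IsInvertible ((Ideal.span {x} : Ideal D) : FractionalIdeal D⁰ K) := by
  refine (isInvertible_iff hstar).2 ⟨by simpa using hx, fun P _ =>
    ⟨x, Ideal.mem_span_singleton_self x, 1, P.2.one_notMem, fun y hy => ?_⟩⟩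
  rw [one_mul]
  exact Ideal.mem_span_singleton.1 hy

/-! ### Type 1 almost super-SH domains -/

namespace IsTypeOneAlmostSuperSHDomain

theorem exists_le (h : star.IsTypeOneAlmostSuperSHDomain) {N : Ideal D} (hN : N.IsPrime)
    (hN0 : N ≠ ⊥) : ∃ A ≤ N, star.IsTypeOneAlmostSuperHomogeneous A := by
  obtain ⟨x, hxN, hx⟩ := Submodule.exists_mem_ne_zero_of_ne_bot hN0
  obtain ⟨l, -, hl, heq⟩ := h x hx fun hu => hN.ne_top (Ideal.eq_top_of_isUnit_mem _ hxN hu)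
  have hle : l.prod ≤ N := (star.le_closure _).trans
    (heq ▸ (Ideal.span_singleton_le_iff_mem N).2 hxN)
  rw [← Multiset.prod_coe, hN.multiset_prod_le] at hle
  obtain ⟨A, hA, hAN⟩ := hle
  exact ⟨A, hAN, hl A hA⟩

theorem isLocallyFiniteFamily (h : star.IsTypeOneAlmostSuperSHDomain) :
    IsLocallyFiniteFamily star.maxSpec := by
  intro x hx hu
  obtain ⟨l, -, hl, heq⟩ := h x hx hu
  -- Each factor lies in one maximal `∗`-ideal only.
  have hfin : (⋃ A ∈ {A | A ∈ l}, {P ∈ star.maxSpec | A ≤ P.asIdeal}).Finite := by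
    refine (List.finite_toSet l).biUnion fun A hA => ?_
    obtain ⟨P, hP, -⟩ := (hl A hA).2
    exact (Set.finite_singleton P).subset fun Q hQ => hP.2.2.2.2 Q hQ.1 hQ.2
  refine hfin.subset ?_
  rintro P ⟨hP, hxP⟩
  have hle : l.prod ≤ P.asIdeal := (star.le_closure _).trans
    (heq ▸ (Ideal.span_singleton_le_iff_mem _).2 hxP)
  rw [← Multiset.prod_coe, P.2.multiset_prod_le] at hle
  obtain ⟨A, hA, hAP⟩ := hle
  exact Set.mem_biUnion hA ⟨hP, hAP⟩

/-- A nonzero prime `N` inside a maximal `∗`-ideal `P` contains one of the homogeneous factors `A`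
of a principal ideal, and even `A_∗` since `A` is principal at `P`; type 1 gives `P ⊆ N`. -/
theorem maxSpec_subset_heightOnePrimes (hstar : star.IsFiniteCharacter)
    (h : star.IsTypeOneAlmostSuperSHDomain) : star.maxSpec ⊆ heightOnePrimes D := by
  intro P hP
  refine mem_heightOnePrimes_of_forall (ne_bot_of_mem_maxSpec hP) fun N hN hN0 hNP =>
    hNP.antisymm ?_
  obtain ⟨A, hAN, hA, P', hAP', hrad⟩ := h.exists_le hN hN0
  obtain rfl := hAP'.2.2.2.2 P hP (hAN.trans hNP)
  obtain ⟨a, ha, s, hs, hdvd⟩ := ((isInvertible_iff hstar).1 hA.1).2 P hP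
  rw [hrad, hN.radical_le_iff]
  intro y hy
  exact (hN.mem_or_mem (N.mem_of_dvd (dvd_mul_of_mem_closure hdvd hy) (hAN ha))).resolve_left
    fun hsN => hs (hNP hsN)

/-- Let `A` be an almost super-homogeneous ideal inside `P`.  For nonzero `a, b ∈ P` take
homogeneous ideals `B ∋ a` and `C ∋ b` at `P` with `B D_P = a D_P` and `C D_P = b D_P`.  A power of
`A` lies in `B_∗`, so for some `n` the `n`-th powers of the generators of `B + C` generate an
invertible ideal.  In `D_P` it is generated by one of them, which is a multiple of `aⁿ` or `bⁿ`. -/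
theorem isLocallyAV (hstar : star.IsFiniteCharacter) (h : star.IsTypeOneAlmostSuperSHDomain) :
    star.IsLocallyAV := by
  have hmax := maxSpec_eq_heightOnePrimes hstar (h.maxSpec_subset_heightOnePrimes hstar)
  have hind : IsIndependentFamily star.maxSpec := hmax ▸ isIndependentFamily_heightOnePrimes
  have hfin := h.isLocallyFiniteFamily
  refine isLocallyAV_iff.2 fun P hP a b => ?_
  by_cases haP : a ∈ P.asIdeal
  swap
  · exact ⟨1, le_rfl, Or.inl (by simpa using .of_notMem haP b)⟩
  by_cases hbP : b ∈ P.asIdeal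
  swap
  · exact ⟨1, le_rfl, Or.inr (by simpa using .of_notMem hbP a)⟩
  rcases eq_or_ne a 0 with rfl | ha
  · exact ⟨1, le_rfl, Or.inr (.of_dvd (by simp))⟩
  rcases eq_or_ne b 0 with rfl | hb
  · exact ⟨1, le_rfl, Or.inl (.of_dvd (by simp))⟩
  obtain ⟨A, hAP, ⟨-, P', hA, hsuper⟩, -⟩ := h.exists_le P.2 (ne_bot_of_mem_maxSpec hP)
  obtain rfl := hA.2.2.2.2 P hP hAP
  obtain ⟨B, hB, -, haB, s, hs, hsB⟩ := exists_isHomogeneousAt hstar hind hfin hP ha haP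
  obtain ⟨C, hC, -, hbC, t, ht, htC⟩ := exists_isHomogeneousAt hstar hind hfin hP hb hbP
  -- Generators of `B + C` that include `a` and `b`.
  obtain ⟨S, rfl⟩ := hB.2.1
  obtain ⟨T, rfl⟩ := hC.2.1
  classical
  set U : Finset D := insert a (insert b (S ∪ T)) with hU
  have hUloc : ∀ u ∈ U, u ∈ P.asIdeal ∧
      (LocallyDvd P.asIdeal a u ∨ LocallyDvd P.asIdeal b u) := by
    intro u hu
    have hor : LocallyDvd P.asIdeal a u ∨ LocallyDvd P.asIdeal b u := by
      simp only [hU, Finset.mem_insert, Finset.mem_union] at hu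
      rcases hu with rfl | rfl | hu | hu
      · exact Or.inl (.of_dvd dvd_rfl)
      · exact Or.inr (.of_dvd dvd_rfl)
      · exact Or.inl ⟨s, hs, hsB u (Submodule.subset_span hu)⟩
      · exact Or.inr ⟨t, ht, htC u (Submodule.subset_span hu)⟩
    exact ⟨hor.elim (fun h => h.mem haP) fun h => h.mem hbP, hor⟩
  obtain ⟨r, hr⟩ : ∃ r : ℕ, A ^ r ≤ star.closure (Submodule.span D (S : Set D)) :=
    Ideal.exists_pow_le_of_le_radical_of_fg
      (hAP.trans (hB.isTypeOne hstar (hmax ▸ hP)).le) hA.2.1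
  let f : Fin U.card → D := fun i => U.equivFin.symm i
  have hf (u : D) (hu : u ∈ U) : ∃ i, f i = u := ⟨U.equivFin ⟨u, hu⟩, by simp [f]⟩
  obtain ⟨n, hn, hinv⟩ := hsuper U.card f (fun i => (hUloc _ (U.equivFin.symm i).2).1)
    ⟨r + 1, by omega, (Ideal.pow_le_pow_right (Nat.le_succ r)).trans (hr.trans
      (star.closure_mono (Submodule.span_mono fun u hu => hf u (by simp_all))))⟩
  obtain ⟨hne, hloc⟩ := (isInvertible_iff hstar).1 hinv
  obtain ⟨c, hc, d, hd, hdvd⟩ := hloc P hP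
  obtain ⟨i, hi⟩ := exists_generator_dvd hne hc hd hdvd
  have hpow {u : D} (hu : u ∈ U) : LocallyDvd P.asIdeal (f i ^ n) (u ^ n) := by
    obtain ⟨j, rfl⟩ := hf u hu
    exact hi _ (Ideal.subset_span ⟨j, rfl⟩)
  refine ⟨n, hn, ?_⟩
  rcases (hUloc _ (U.equivFin.symm i).2).2 with hai | hbi
  · exact Or.inl ((hai.pow n).trans (hpow (by simp [hU])))
  · exact Or.inr ((hbi.pow n).trans (hpow (by simp [hU])))

theorem isAGKD (hstar : star.IsFiniteCharacter) (h : star.IsTypeOneAlmostSuperSHDomain) :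
    star.IsAGKD := by
  have h1 := h.maxSpec_subset_heightOnePrimes hstar
  have hmax := maxSpec_eq_heightOnePrimes hstar h1
  exact IsHLocal.isAGKD hstar ⟨isDefiningFamily_maxSpec hstar,
    hmax ▸ isIndependentFamily_heightOnePrimes, h.isLocallyFiniteFamily⟩ (h.isLocallyAV hstar) h1

end IsTypeOneAlmostSuperSHDomain

end StarOperation

end

/-! ### The equivalences -/

theorem theorem4p3 {D : Type*} [CommRing D] [IsDomain D]
    {K : Type*} [Field K] [Algebra D K] [IsFractionRing D K]
    (star : StarOperation D K) (hstar : star.IsFiniteCharacter) :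
    List.TFAE [
      star.IsAGKD,
      star.IsAPMD ∧ star.IsWKD,
      star.IsPotent ∧ star.IsAPMD ∧ heightOnePrimes D = star.maxSpec,
      star.IsAlmostIRKT ∧ star.IsWKD,
      star.IsAlmostIRKT ∧
        ∀ A : Ideal D, star.IsInvertible (A : FractionalIdeal D⁰ K) → star.IsHomogeneous A →
          star.IsTypeOne A,
      star.IsHLocal ∧
        ∀ A : Ideal D, star.IsInvertible (A : FractionalIdeal D⁰ K) → star.IsHomogeneous A →
          star.IsAlmostSuperHomogeneous A ∧ star.IsTypeOne A,
      star.IsTypeOneAlmostSuperSHDomain,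
      ∀ A : Ideal D, A.FG → star.IsInvertible (A : FractionalIdeal D⁰ K) → star.closure A ≠ ⊤ →
        star.IsStarProductOf star.IsTypeOneAlmostSuperHomogeneous (star.closure A)] := by
  tfae_have 1 → 2 := fun h => ⟨h.2.2.isAPMD hstar h.isHLocal.2.2, h.isHLocal, h.2.1⟩
  tfae_have 2 → 3 := fun h =>
    ⟨StarOperation.isPotent_of_isLocallyFiniteFamily h.2.1.2.2, h.1, h.2.2.symm⟩
  tfae_have 3 → 1 := fun h => by
    have hfin := StarOperation.isLocallyFiniteFamily_of_isPotent hstar h.1 h.2.2.ge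
    have hdef := StarOperation.isDefiningFamily_maxSpec hstar
    rw [← h.2.2] at hfin hdef
    exact ⟨⟨hdef, hfin⟩, h.2.2.symm, h.2.1.isLocallyAV hstar⟩
  tfae_have 1 → 4 := fun h => ⟨⟨h.isHLocal, h.2.2⟩, h.isHLocal, h.2.1⟩
  tfae_have 4 → 1 := fun h => h.1.1.isAGKD hstar h.1.2 h.2.2.le
  tfae_have 1 → 5 := fun h => ⟨⟨h.isHLocal, h.2.2⟩, fun A hinv hA =>
    (h.isTypeOneAlmostSuperHomogeneous hstar hinv hA).2⟩
  tfae_have 5 → 1 := fun h => h.1.1.isAGKD hstar h.1.2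
    (StarOperation.maxSpec_subset_heightOnePrimes hstar h.1.1 h.2)
  tfae_have 1 → 6 := fun h => ⟨h.isHLocal, fun A hinv hA =>
    h.isTypeOneAlmostSuperHomogeneous hstar hinv hA⟩
  tfae_have 6 → 8 := fun h A _ hinv hA => by
    obtain ⟨l, hl0, hl, heq⟩ := h.1.isStarProductOf hstar hinv hA
    exact ⟨l, hl0, fun B hB => h.2 B (hl B hB).1 (hl B hB).2, heq⟩
  tfae_have 8 → 7 := fun h x hx hu => by
    have hcl := star.closure_span_singleton x
    have := h (Ideal.span {x}) (Submodule.fg_span_singleton x)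
      (StarOperation.isInvertible_span_singleton hstar hx)
      (by rwa [hcl, Ne, Ideal.span_singleton_eq_top])
    rwa [hcl] at this
  tfae_have 7 → 1 := fun h => h.isAGKD hstar
  tfae_finish
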